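/- Let $\ell\ge 1$ and let $\Delta$ be the root system of type $B_\ell$ with simple roots $\alpha_i$ ($i\in I=\{1,\dots,\ell\}$), realized in $\bigoplus_i\mathbb{Q}\varepsilon_i$ as $\Delta=\{\pm\varepsilon_i\}\sqcup\{\pm\varepsilon_i\pm\varepsilon_j : i\ne j\}$ (short and long roots; for $\ell=1$ all roots are short), with $\alpha_i=\varepsilon_i-\varepsilon_{i+1}$ for $i<\ell$ and $\alpha_\ell=\varepsilon_\ell$, standard form $(\cdot,\cdot)$, coroots $\alpha^\vee=2\alpha/(\alpha,\alpha)$, positive roots $\Delta^+$, root lattice $Q$, Weyl group $W$, length function $\ell(\cdot)$ and reflections $s_\gamma$. The real roots of the affine root system of type $A_{2\ell}^{(2)}$ (with $\alpha_0=\delta-2\varepsilon_1$) are $$\Delta_{\mathrm{af}}=\{\alpha+n\delta : \alpha\in\Delta,\ n\in\mathbb{Z}\}\sqcup\{2\alpha+(2n+1)\delta : \alpha\in\Delta\text{ short},\ n\in\mathbb{Z}\};$$ such a root is positive (is in $\Delta_{\mathrm{af}}^+$) if its $\delta$-coefficient is positive, or is zero and the root lies in $\Delta^+$. The affine Weyl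 group $W_{\mathrm{af}}=\langle s_\beta : \beta\in\Delta_{\mathrm{af}}\rangle = W\ltimes\{t_\xi : \xi\in Q\}$, where $t_\xi(v+n\delta)=v+(n-(v,\xi))\delta$, has the semi-infinite length $\ell^{\frac{\infty}{2}}(wt_\xi)=\ell(w)+2\langle\rho^\vee,\xi\rangle$ ($w\in W$, $\xi\in Q$), where $\rho^\vee=\frac12\sum_{\alpha\in\Delta^+}\alpha^\vee$. Let $J\subset I$. Let $W_J=\langle s_{\alpha_j}: j\in J\rangle$, $\Delta_J^+=\Delta^+\cap\sum_{j\in J}\mathbb{Q}\alpha_j$, $\rho_J^\vee=\frac12\sum_{\alpha\in\Delta_J^+}\alpha^\vee$; let $W^J\subset W$ be the set of minimal-length representatives of $W/W_J$, and $\lfloor w\rfloor^J\in W^J$ the representative of $wW_J$. Let $(W^J)_{\mathrm{af}}$ be the set of $x\in W_{\mathrm{af}}$ such that $x\beta\in\Delta_{\mathrm{af}}^+$ for all $\beta\in\Delta_{\mathrm{af}}^+\cap(\mathbb{Q}\delta+\sum_{j\in J}\mathbb{Q}\alpha_j)$. An element $\xi\in Q$ is $J$-adjusted if $\langle\gamma^\vee,\xi\rangle\in\{-1,0\}$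 for all $\gamma\in\Delta_J^+$; for such $\xi$, $z_\xi$ is the unique element of $W_J$ with $z_\xi t_\xi\in(W^J)_{\mathrm{af}}$. In the semi-infinite Bruhat graph $\tfrac{\infty}{2}\mathrm{BG}^J$, with vertex set $(W^J)_{\mathrm{af}}$, there is an edge $x\xrightarrow{\beta}y$ with $\beta\in\Delta_{\mathrm{af}}^+$ if $y=s_\beta x$ and $\ell^{\frac{\infty}{2}}(y)=\ell^{\frac{\infty}{2}}(x)+1$. In the parabolic quantum Bruhat graph $\mathrm{QBG}^J_{A_{2\ell}^{(2)}}$, with vertex set $W^J$, there is an edge $w\xrightarrow{\gamma}v$ with $\gamma\in\Delta^+\setminus\Delta_J^+$ if $v=\lfloor ws_\gamma\rfloor^J$ and either $\ell(v)=\ell(w)+1$ (a Bruhat edge) or $\ell(v)=\ell(w)-2\langle\rho^\vee-\rho_J^\vee,\gamma\rangle+1$ (a quantum edge). Then the following hold. 1. Let $x=wz_\xi t_\xi$ with $w\in W^J$ and $\xi$ $J$-adjusted, let $\beta\in\Delta_{\mathrm{af}}^+$, suppose that $x\xrightarrow{\beta}s_\beta x$ in $\tfrac{\infty}{2}\mathrm{BG}^J$,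 and let $\gamma\in\Delta^+\setminus\Delta_J^+$. If $\beta=w\gamma$, then $w\xrightarrow{\gamma}\lfloor ws_\gamma\rfloor^J$ is a Bruhat edge in $\mathrm{QBG}^J_{A_{2\ell}^{(2)}}$. If $\beta=w\gamma+\delta$ or $\beta=2w\gamma+\delta$, then $w\xrightarrow{\gamma}\lfloor ws_\gamma\rfloor^J$ is a quantum edge in $\mathrm{QBG}^J_{A_{2\ell}^{(2)}}$. 2. Let $w\in W^J$ and $\gamma\in\Delta^+\setminus\Delta_J^+$, and suppose that $w\xrightarrow{\gamma}\lfloor ws_\gamma\rfloor^J$ is an edge in $\mathrm{QBG}^J_{A_{2\ell}^{(2)}}$. Put $\beta=w\gamma$ if it is a Bruhat edge, $\beta=w\gamma+\delta$ if it is a quantum edge and $\gamma$ is long, and $\beta=2w\gamma+\delta$ if it is a quantum edge and $\gamma$ is short. Then $\beta\in\Delta_{\mathrm{af}}^+$, and $wz_\xi t_\xi\xrightarrow{\beta}s_\beta wz_\xi t_\xi$ in $\tfrac{\infty}{2}\mathrm{BG}^J$ for every $J$-adjusted $\xi$. -/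

import Mathlib

/-!
The affine root system of type `A_{2ℓ}^{(2)}`, in the labelling where the finite part is of
type `B_ℓ` and `α₀ = δ - 2ε₁` (so the null root is `δ = α₀ + 2(α₁ + ⋯ + α_ℓ)`), its affine Weyl
group, the semi-infinite Bruhat graph and the quantum Bruhat graph.

The space spanned by the finite roots is `ℚ^ℓ` with orthonormal basis `ε₁, …, ε_ℓ`
(indexed by `Fin ℓ`), and `h` is identified with `h*` by the standard form, so that the coroot
of `α` is `2α/(α,α)`. The pair `(v, n) : ℚ^ℓ × ℚ` stands for `v + nδ`.
The index set `I` of the finite simple roots is `Fin ℓ`.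
-/

namespace TwistedA

open scoped Matrix

/-- The span of the finite roots. -/
abbrev FinSpace (ℓ : ℕ) : Type := Fin ℓ → ℚ

/-- The span of the affine real roots; `(v, n)` stands for `v + n δ`. -/
abbrev AffSpace (ℓ : ℕ) : Type := (Fin ℓ → ℚ) × ℚ

variable {ℓ : ℕ}

/-- The basis vector `ε_i`. -/
def eps (i : Fin ℓ) : FinSpace ℓ := Pi.single i 1

/-- The simple roots of type `B_ℓ`: `ε_i - ε_{i+1}` for `i` not last, and `ε_ℓ`
for the last index. -/
def simpleRoot (i : Fin ℓ) : FinSpace ℓ :=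
  if h : (i : ℕ) + 1 < ℓ then eps i - eps ⟨(i : ℕ) + 1, h⟩ else eps i

/-- The short roots `± ε_i` (for `ℓ = 1` all roots are short). -/
def shortRoots (ℓ : ℕ) : Set (FinSpace ℓ) := {α | ∃ i, α = eps i ∨ α = -eps i}

/-- The long roots `± ε_i ± ε_j`, `i ≠ j`. -/
def longRoots (ℓ : ℕ) : Set (FinSpace ℓ) :=
  {α | ∃ i j, i ≠ j ∧ (α = eps i + eps j ∨ α = eps i - eps j ∨ α = -eps i - eps j)}

/-- The finite root system `Δ`. -/
def roots (ℓ : ℕ) : Set (FinSpace ℓ) := shortRoots ℓ ∪ longRoots ℓ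

/-- The positive roots `Δ⁺`: roots that are sums of simple roots. -/
def posRoots (ℓ : ℕ) : Set (FinSpace ℓ) :=
  {α | α ∈ roots ℓ ∧ α ∈ AddSubmonoid.closure (Set.range (simpleRoot (ℓ := ℓ)))}

/-- The linear span of the simple roots `α_j`, `j ∈ J`. -/
def spanJ (J : Set (Fin ℓ)) : Submodule ℚ (FinSpace ℓ) := Submodule.span ℚ (simpleRoot '' J)

/-- `Δ_J⁺`: the positive roots in the span of the `α_j`, `j ∈ J`. -/
def posRootsJ (J : Set (Fin ℓ)) : Set (FinSpace ℓ) := {α | α ∈ posRoots ℓ ∧ α ∈ spanJ J}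

/-- The root lattice `Q`. -/
def rootLattice (ℓ : ℕ) : AddSubgroup (FinSpace ℓ) := AddSubgroup.closure (roots ℓ)

/-- The coroot `α^∨ = 2α/(α,α)`. The pairing `⟨α^∨, v⟩` is the dot product with it. -/
def coroot (α : FinSpace ℓ) : FinSpace ℓ := (2 / (α ⬝ᵥ α)) • α

/-- Half the sum of the coroots of the roots in a (finite) set `S`. -/
noncomputable def halfSumCoroots (S : Set (FinSpace ℓ)) : FinSpace ℓ :=
  (1 / 2 : ℚ) • ∑ᶠ α ∈ S, coroot α

/-- `ρ^∨`. -/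
noncomputable def rhoCheck (ℓ : ℕ) : FinSpace ℓ := halfSumCoroots (posRoots ℓ)

/-- `ρ_J^∨`. -/
noncomputable def rhoCheckJ (J : Set (Fin ℓ)) : FinSpace ℓ := halfSumCoroots (posRootsJ J)

theorem coroot_dotProduct_self {α : FinSpace ℓ} (h : α ≠ 0) : coroot α ⬝ᵥ α = 2 := by
  have : α ⬝ᵥ α ≠ 0 := fun h0 => h (dotProduct_self_eq_zero.mp h0)
  simp only [coroot, smul_dotProduct, smul_eq_mul]
  field_simp

/-- The set `Δ` is finite, so that the sums defining `ρ^∨` and `ρ_J^∨` are genuine. -/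
theorem roots_finite (ℓ : ℕ) : (roots ℓ).Finite := by
  have h : roots ℓ ⊆
      Set.range (fun i : Fin ℓ => eps i) ∪ Set.range (fun i : Fin ℓ => -eps i) ∪
      (Set.range (fun p : Fin ℓ × Fin ℓ => eps p.1 + eps p.2) ∪
       Set.range (fun p : Fin ℓ × Fin ℓ => eps p.1 - eps p.2) ∪
       Set.range (fun p : Fin ℓ × Fin ℓ => -eps p.1 - eps p.2)) := by
    rintro α (⟨i, rfl | rfl⟩ | ⟨i, j, -, rfl | rfl | rfl⟩)
    · exact Or.inl (Or.inl ⟨i, rfl⟩)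
    · exact Or.inl (Or.inr ⟨i, rfl⟩)
    · exact Or.inr (Or.inl (Or.inl ⟨(i, j), rfl⟩))
    · exact Or.inr (Or.inl (Or.inr ⟨(i, j), rfl⟩))
    · exact Or.inr (Or.inr ⟨(i, j), rfl⟩)
  exact Set.Finite.subset (Set.toFinite _) h

/-! ### The finite Weyl group -/

/-- The reflection `s_α : v ↦ v - ⟨α^∨, v⟩ α`. -/
def reflection (α : FinSpace ℓ) : FinSpace ℓ ≃ₗ[ℚ] FinSpace ℓ :=
  LinearEquiv.ofInvolutive
    { toFun := fun v => v - (coroot α ⬝ᵥ v) • α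
      map_add' := by intro u v; simp only [dotProduct_add, add_smul]; abel
      map_smul' := by
        intro c v
        simp only [dotProduct_smul, smul_sub, smul_smul, smul_eq_mul, RingHom.id_apply] }
    (by
      intro v
      by_cases h : α = 0
      · simp [h]
      · simp only [LinearMap.coe_mk, AddHom.coe_mk, dotProduct_sub, dotProduct_smul,
          coroot_dotProduct_self h, smul_eq_mul]
        module)

/-- The parabolic subgroup `W_J`, generated by the simple reflections `s_j`, `j ∈ J`. -/
def weylGroupJ (J : Set (Fin ℓ)) : Subgroup (FinSpace ℓ ≃ₗ[ℚ] FinSpace ℓ) :=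
  Subgroup.closure ((fun j => reflection (simpleRoot j)) '' J)

/-- The finite Weyl group `W`. -/
def weylGroup (ℓ : ℕ) : Subgroup (FinSpace ℓ ≃ₗ[ℚ] FinSpace ℓ) := weylGroupJ Set.univ

/-- The length of `w ∈ W` with respect to the simple reflections. -/
noncomputable def length (w : FinSpace ℓ ≃ₗ[ℚ] FinSpace ℓ) : ℕ :=
  sInf {n | ∃ l : List (Fin ℓ),
    l.length = n ∧ (l.map fun i => reflection (simpleRoot i)).prod = w}

/-- `W^J`: the elements of `W` of minimal length in their coset modulo `W_J`. -/
def minReps (J : Set (Fin ℓ)) : Set (FinSpace ℓ ≃ₗ[ℚ] FinSpace ℓ) :=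
  {w | w ∈ weylGroup ℓ ∧ ∀ u ∈ weylGroupJ J, length w ≤ length (w * u)}

/-- `⌊w⌋^J`: the element of minimal length in the coset `w W_J`. -/
noncomputable def minRep (J : Set (Fin ℓ)) (w : FinSpace ℓ ≃ₗ[ℚ] FinSpace ℓ) :
    FinSpace ℓ ≃ₗ[ℚ] FinSpace ℓ :=
  Function.argminOn length {v | ∃ u ∈ weylGroupJ J, v = w * u}
    ⟨w, 1, one_mem _, (mul_one w).symm⟩

/-! ### Affine real roots and the affine Weyl group -/

/-- The real roots `Δ_af`: `α + nδ` for `α ∈ Δ`, and `2α + (2n+1)δ` for `α ∈ Δ` short. -/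
def affRoots (ℓ : ℕ) : Set (AffSpace ℓ) :=
  {β | (∃ α ∈ roots ℓ, ∃ n : ℤ, β = (α, (n : ℚ))) ∨
       (∃ α ∈ shortRoots ℓ, ∃ n : ℤ, β = ((2 : ℚ) • α, 2 * (n : ℚ) + 1))}

/-- The positive real roots `Δ_af⁺`: the `δ`-coefficient is positive, or it is zero and the
root lies in `Δ⁺`. -/
def posAffRoots (ℓ : ℕ) : Set (AffSpace ℓ) :=
  {β | β ∈ affRoots ℓ ∧ (0 < β.2 ∨ (β.2 = 0 ∧ β.1 ∈ posRoots ℓ))}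

/-- The reflection `s_β` in a real root `β`: `x ↦ x - ⟨β^∨, x⟩ β`. As `δ` pairs to zero with
everything here, the pairing sees only the finite parts of `β` and `x`. -/
def affReflection (β : AffSpace ℓ) : AffSpace ℓ ≃ₗ[ℚ] AffSpace ℓ :=
  LinearEquiv.ofInvolutive
    { toFun := fun x => x - (coroot β.1 ⬝ᵥ x.1) • β
      map_add' := by intro u v; simp only [Prod.fst_add, dotProduct_add, add_smul]; abel
      map_smul' := by
        intro c v
        simp only [Prod.smul_fst, dotProduct_smul, smul_sub, smul_smul, smul_eq_mul,
          RingHom.id_apply] }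
    (by
      intro v
      by_cases h : β.1 = 0
      · simp [h, coroot]
      · simp only [LinearMap.coe_mk, AddHom.coe_mk, Prod.fst_sub, Prod.smul_fst, dotProduct_sub,
          dotProduct_smul, coroot_dotProduct_self h, smul_eq_mul]
        module)

/-- The affine Weyl group `W_af`, generated by the reflections in the real roots. -/
def affWeylGroup (ℓ : ℕ) : Subgroup (AffSpace ℓ ≃ₗ[ℚ] AffSpace ℓ) :=
  Subgroup.closure (affReflection '' affRoots ℓ)

/-- The inclusion of `W` into `W_af`: `w (v + nδ) = w v + nδ`. -/
def incl (w : FinSpace ℓ ≃ₗ[ℚ] FinSpace ℓ) : AffSpace ℓ ≃ₗ[ℚ] AffSpace ℓ :=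
  LinearEquiv.prodCongr w (LinearEquiv.refl ℚ ℚ)

/-- The translation `t_ξ`: `v + nδ ↦ v + (n - (v, ξ))δ`. -/
def transl (ξ : FinSpace ℓ) : AffSpace ℓ ≃ₗ[ℚ] AffSpace ℓ :=
  { toFun := fun x => (x.1, x.2 - x.1 ⬝ᵥ ξ)
    invFun := fun x => (x.1, x.2 + x.1 ⬝ᵥ ξ)
    map_add' := by
      intro x y
      ext
      · simp
      · simp only [Prod.snd_add, Prod.fst_add, add_dotProduct]; ring
    map_smul' := by
      intro c x
      ext
      · simp
      · simp only [Prod.smul_snd, Prod.smul_fst, smul_dotProduct, smul_eq_mul,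
          RingHom.id_apply]; ring
    left_inv := by intro x; simp
    right_inv := by intro x; simp }

open Classical in
/-- The semi-infinite length `ℓ^{∞/2}(w t_ξ) = ℓ(w) + 2⟨ρ^∨, ξ⟩` for `w ∈ W`, `ξ ∈ Q`. -/
noncomputable def siLength (x : AffSpace ℓ ≃ₗ[ℚ] AffSpace ℓ) : ℚ :=
  if h : ∃ p : (FinSpace ℓ ≃ₗ[ℚ] FinSpace ℓ) × FinSpace ℓ,
      p.1 ∈ weylGroup ℓ ∧ p.2 ∈ rootLattice ℓ ∧ x = incl p.1 * transl p.2 then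
    (length h.choose.1 : ℚ) + 2 * (rhoCheck ℓ ⬝ᵥ h.choose.2)
  else 0

/-- The decomposition `x = w t_ξ` is unique. -/
theorem incl_mul_transl_injective {w w' : FinSpace ℓ ≃ₗ[ℚ] FinSpace ℓ} {ξ ξ' : FinSpace ℓ}
    (h : incl w * transl ξ = incl w' * transl ξ') : w = w' ∧ ξ = ξ' := by
  have key : ∀ v : FinSpace ℓ, (w v, 0 - v ⬝ᵥ ξ) = (w' v, 0 - v ⬝ᵥ ξ') := fun v =>
    congrArg (fun f : AffSpace ℓ ≃ₗ[ℚ] AffSpace ℓ => f (v, 0)) h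
  constructor
  · exact LinearEquiv.ext fun v => (Prod.ext_iff.mp (key v)).1
  · refine dotProduct_eq _ _ fun v => ?_
    have := (Prod.ext_iff.mp (key v)).2
    simp only [zero_sub, neg_inj] at this
    rw [dotProduct_comm ξ, dotProduct_comm ξ', this]

theorem siLength_incl_mul_transl {w : FinSpace ℓ ≃ₗ[ℚ] FinSpace ℓ} {ξ : FinSpace ℓ}
    (hw : w ∈ weylGroup ℓ) (hξ : ξ ∈ rootLattice ℓ) :
    siLength (incl w * transl ξ) = (length w : ℚ) + 2 * (rhoCheck ℓ ⬝ᵥ ξ) := by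
  have h : ∃ p : (FinSpace ℓ ≃ₗ[ℚ] FinSpace ℓ) × FinSpace ℓ,
      p.1 ∈ weylGroup ℓ ∧ p.2 ∈ rootLattice ℓ ∧
        incl w * transl ξ = incl p.1 * transl p.2 := ⟨(w, ξ), hw, hξ, rfl⟩
  obtain ⟨h1, h2⟩ := incl_mul_transl_injective h.choose_spec.2.2
  rw [siLength, dif_pos h, ← h1, ← h2]

/-! ### The semi-infinite Bruhat graph -/

/-- `(W^J)_af`: the `x ∈ W_af` with `x β ∈ Δ_af⁺` for every positive real root `β` whose finite
part lies in the span of the `α_j`, `j ∈ J`. -/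
def petersonReps (J : Set (Fin ℓ)) : Set (AffSpace ℓ ≃ₗ[ℚ] AffSpace ℓ) :=
  {x | x ∈ affWeylGroup ℓ ∧ ∀ β ∈ posAffRoots ℓ, β.1 ∈ spanJ J → x β ∈ posAffRoots ℓ}

/-- The set of `J`-adjusted elements of `Q`. -/
def adjusted (J : Set (Fin ℓ)) : Set (FinSpace ℓ) :=
  {ξ | ξ ∈ rootLattice ℓ ∧ ∀ γ ∈ posRootsJ J, coroot γ ⬝ᵥ ξ = -1 ∨ coroot γ ⬝ᵥ ξ = 0}

open Classical in
/-- For `J`-adjusted `ξ`, the (unique) element `z_ξ ∈ W_J` with `z_ξ t_ξ ∈ (W^J)_af`. -/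
noncomputable def zElt (J : Set (Fin ℓ)) (ξ : FinSpace ℓ) : FinSpace ℓ ≃ₗ[ℚ] FinSpace ℓ :=
  if h : ∃ z, z ∈ weylGroupJ J ∧ incl z * transl ξ ∈ petersonReps J then h.choose else 1

/-- The edge `x → y` labelled by `β` in the semi-infinite Bruhat graph `(∞/2)BG^J`. -/
def SiBGEdge (J : Set (Fin ℓ)) (x : AffSpace ℓ ≃ₗ[ℚ] AffSpace ℓ) (β : AffSpace ℓ)
    (y : AffSpace ℓ ≃ₗ[ℚ] AffSpace ℓ) : Prop :=
  x ∈ petersonReps J ∧ y ∈ petersonReps J ∧ β ∈ posAffRoots ℓ ∧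
    y = affReflection β * x ∧ siLength y = siLength x + 1

/-! ### The quantum Bruhat graph -/

/-- The Bruhat edge `w → v` labelled by `γ` in `QBG^J`. -/
def QBGBruhatEdge (J : Set (Fin ℓ)) (w : FinSpace ℓ ≃ₗ[ℚ] FinSpace ℓ) (γ : FinSpace ℓ)
    (v : FinSpace ℓ ≃ₗ[ℚ] FinSpace ℓ) : Prop :=
  w ∈ minReps J ∧ v ∈ minReps J ∧ γ ∈ posRoots ℓ \ posRootsJ J ∧
    v = minRep J (w * reflection γ) ∧ length v = length w + 1

/-- The quantum edge `w → v` labelled by `γ` in `QBG^J`. -/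
def QBGQuantumEdge (J : Set (Fin ℓ)) (w : FinSpace ℓ ≃ₗ[ℚ] FinSpace ℓ) (γ : FinSpace ℓ)
    (v : FinSpace ℓ ≃ₗ[ℚ] FinSpace ℓ) : Prop :=
  w ∈ minReps J ∧ v ∈ minReps J ∧ γ ∈ posRoots ℓ \ posRootsJ J ∧
    v = minRep J (w * reflection γ) ∧
    (length v : ℚ) = length w - 2 * ((rhoCheck ℓ - rhoCheckJ J) ⬝ᵥ γ) + 1

end TwistedA

open TwistedA

/-! Everything rests on one factorization. For `β = wγ`, `wγ + δ` (with `γ` long) or `2wγ + δ` (with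
`γ` short) one has `s_β w = w s_γ t_ζ` with `ζ = 0`, `γ`, `γ` respectively, so that `s_β x = (w s_γ
t_ζ)(z_ξ t_ξ)`. An element `u t_ζ` lies in `(W^J)_af` exactly when `⟨η^∨, ζ⟩` is `-1` or `0` for
each `η ∈ Δ_J⁺`, according as `uη` is negative or positive (`SignCompatible`). Summing over `Δ_J⁺`,
the contribution of `2ρ_J^∨` cancels the inversions of `u` in `Δ_J⁺`, and the semi-infinite length
becomes `ℓ(⌊u⌋^J) + 2⟨ρ^∨ - ρ_J^∨, ζ⟩` (`siLength_of_mem_petersonReps`). As `ρ^∨ - ρ_J^∨` is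
`W_J`-invariant, the factor `z_ξ t_ξ` shifts both lengths equally. Hence, once `s_β x` is in
`(W^J)_af`, the covering condition is `ℓ(⌊w s_γ⌋^J) = ℓ(w) - 2⟨ρ^∨ - ρ_J^∨, ζ⟩ + 1`: the Bruhat
condition for `ζ = 0`, the quantum one for `ζ = γ` (`siLength_covers_iff`).

Two matters remain. First, `β = wγ + δ` with `γ` short gives `ζ = 2γ`, which must be shown never to
produce an edge; a length estimate does it (`length_mul_reflection_add_four_ne`).

Second, in the converse direction `s_β x ∈ (W^J)_af` has to be deduced from the length equation
alone. Since `z_ξ t_ξ` preserves the positive affine roots over `J`, it is enough that `w s_γ` and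
`ζ` be sign compatible. For a Bruhat edge this says that `w s_γ` is itself minimal in its coset
(`heightComp_pos_of_bruhatEdge`). For a quantum edge it comes from a count over the inversions of
`s_γ` that leaves no slack (`heightComp_of_quantumEdge`). Both use that length counts inversions and
that `ℓ(w s_γ) - ℓ(w)` is the sum of the signs of `wη` over the inversions `η` of `s_γ`. -/

namespace TwistedA

open scoped Matrix

variable {ℓ : ℕ}

/-! ### Coefficients, heights, and roots as integer vectors -/

/-- The coefficient of the simple root `α_j`. -/
def coef (j : Fin ℓ) : FinSpace ℓ →ₗ[ℚ] ℚ := ∑ i ∈ Finset.Iic j, LinearMap.proj i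

/-- The sum of the coefficients with respect to the simple roots. -/
def height : FinSpace ℓ →ₗ[ℚ] ℚ := ∑ j, coef j

/-- The vector has integer coordinates. -/
def IsIntegral (v : FinSpace ℓ) : Prop := ∀ i, ∃ n : ℤ, v i = n

theorem coef_apply (j : Fin ℓ) (v : FinSpace ℓ) : coef j v = ∑ i ∈ Finset.Iic j, v i := by
  simp [coef]

theorem height_apply (v : FinSpace ℓ) : height v = ∑ j, coef j v := by
  simp [height]

theorem coef_eps (j i : Fin ℓ) : coef j (eps i) = if i ≤ j then 1 else 0 := by
  simp only [coef_apply, eps, Pi.single_apply, Finset.sum_ite_eq', Finset.mem_Iic]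

/-- The differences `ε_i - ε_{i+1}` telescope, which is why partial sums of coordinates are the dual
basis of the simple roots. -/
theorem coef_simpleRoot (j i : Fin ℓ) : coef j (simpleRoot i) = if i = j then 1 else 0 := by
  unfold simpleRoot
  split_ifs with h h1 h1
  · subst h1
    rw [map_sub, coef_eps, coef_eps, if_pos le_rfl, if_neg, sub_zero]
    rw [Fin.le_def]
    exact not_le.mpr (Nat.lt_succ_self _)
  · rw [map_sub, coef_eps, coef_eps]
    by_cases h2 : i ≤ j
    · rw [if_pos h2, if_pos, sub_self]
      have : i < j := lt_of_le_of_ne h2 h1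
      rw [Fin.lt_def] at this
      rw [Fin.le_def]
      exact this
    · rw [if_neg h2, if_neg, sub_self]
      simp only [Fin.le_def] at h2 ⊢
      omega
  · subst h1
    rw [coef_eps, if_pos le_rfl]
  · rw [coef_eps, if_neg]
    rw [Fin.le_def]
    have := Fin.val_ne_of_ne h1
    omega

theorem eq_zero_of_coef {v : FinSpace ℓ} (h : ∀ j, coef j v = 0) : v = 0 := by
  funext j
  induction j using WellFoundedLT.induction with
  | ind j ih =>
    have := h j
    rw [coef_apply, Finset.sum_eq_single j] at this
    · exact this
    · intro i hi hij
      exact ih i (lt_of_le_of_ne (Finset.mem_Iic.mp hi) hij)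
    · simp

theorem sum_coef_smul (v : FinSpace ℓ) : ∑ j, coef j v • simpleRoot j = v := by
  rw [← sub_eq_zero]
  refine eq_zero_of_coef fun i => ?_
  simp [coef_simpleRoot]

theorem mem_spanJ_iff {J : Set (Fin ℓ)} {v : FinSpace ℓ} :
    v ∈ spanJ J ↔ ∀ j ∉ J, coef j v = 0 := by
  constructor
  · intro h j hj
    refine Submodule.span_induction (p := fun v _ => coef j v = 0) ?_ (by simp) ?_ ?_ h
    · rintro _ ⟨i, hi, rfl⟩
      rw [coef_simpleRoot, if_neg]
      rintro rfl
      exact hj hi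
    · intro x y _ _ hx hy
      simp [hx, hy]
    · intro a x _ hx
      simp [hx]
  · intro h
    rw [← sum_coef_smul v]
    refine Submodule.sum_mem _ fun j _ => ?_
    by_cases hj : j ∈ J
    · exact Submodule.smul_mem _ _ (Submodule.subset_span ⟨j, hj, rfl⟩)
    · simp [h j hj]

namespace IsIntegral

theorem add {u v : FinSpace ℓ} (hu : IsIntegral u) (hv : IsIntegral v) : IsIntegral (u + v) := by
  intro i
  obtain ⟨a, ha⟩ := hu i
  obtain ⟨b, hb⟩ := hv i
  exact ⟨a + b, by simp [ha, hb]⟩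

theorem neg {v : FinSpace ℓ} (hv : IsIntegral v) : IsIntegral (-v) := by
  intro i
  obtain ⟨b, hb⟩ := hv i
  exact ⟨-b, by simp [hb]⟩

theorem sub {u v : FinSpace ℓ} (hu : IsIntegral u) (hv : IsIntegral v) : IsIntegral (u - v) := by
  rw [sub_eq_add_neg]
  exact hu.add hv.neg

theorem int_smul {v : FinSpace ℓ} (hv : IsIntegral v) (n : ℤ) : IsIntegral ((n : ℚ) • v) := by
  intro i
  obtain ⟨b, hb⟩ := hv i
  exact ⟨n * b, by simp [hb]⟩

theorem dotProduct {u v : FinSpace ℓ} (hu : IsIntegral u) (hv : IsIntegral v) :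
    ∃ n : ℤ, u ⬝ᵥ v = n := by
  choose a ha using hu
  choose b hb using hv
  exact ⟨∑ i, a i * b i, by simp [_root_.dotProduct, ha, hb]⟩

theorem coef {v : FinSpace ℓ} (hv : IsIntegral v) (j : Fin ℓ) :
    ∃ n : ℤ, TwistedA.coef j v = n := by
  choose a ha using hv
  exact ⟨∑ i ∈ Finset.Iic j, a i, by simp [coef_apply, ha]⟩

theorem eps (i : Fin ℓ) : IsIntegral (eps i) := by
  intro j
  by_cases h : j = i
  · exact ⟨1, by simp [TwistedA.eps, h]⟩
  · exact ⟨0, by simp [TwistedA.eps, h]⟩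

end IsIntegral

/-! ### Roots as integral vectors of norm 1 or 2 -/

theorem eps_dotProduct (i : Fin ℓ) (v : FinSpace ℓ) : eps i ⬝ᵥ v = v i := by
  simp [eps]

theorem eps_apply_self (i : Fin ℓ) : eps i i = 1 := by simp [eps]

theorem eps_apply_of_ne {i j : Fin ℓ} (h : j ≠ i) : eps i j = 0 := by simp [eps, h]

/-- Integrality and norm are both preserved by reflections in roots, so this description makes the
Weyl invariance of each root length immediate. -/
theorem mem_shortRoots_iff {v : FinSpace ℓ} :
    v ∈ shortRoots ℓ ↔ IsIntegral v ∧ v ⬝ᵥ v = 1 := by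
  constructor
  · rintro ⟨i, rfl | rfl⟩
    · exact ⟨.eps i, by simp [eps_dotProduct, eps_apply_self]⟩
    · exact ⟨(IsIntegral.eps i).neg, by simp [eps_dotProduct, eps_apply_self]⟩
  · rintro ⟨hv, h1⟩
    have hne : ∃ i, v i ≠ 0 := by
      by_contra! h
      simp [dotProduct, h] at h1
    obtain ⟨i, hi⟩ := hne
    have hint : 1 ≤ v i * v i := by
      obtain ⟨n, hn⟩ := hv i
      rw [hn] at hi ⊢
      have : n ≠ 0 := by exact_mod_cast hi
      have : 1 ≤ n * n := by nlinarith [Int.one_le_abs this, abs_mul_abs_self n]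
      exact_mod_cast this
    have hsum := Finset.add_sum_erase Finset.univ (fun j => v j * v j) (Finset.mem_univ i)
    have hdot : ∑ j, v j * v j = 1 := h1
    have hnn : ∀ j ∈ Finset.univ.erase i, 0 ≤ v j * v j := fun j _ => mul_self_nonneg _
    have h0 : ∑ j ∈ Finset.univ.erase i, v j * v j = 0 :=
      le_antisymm (by linarith) (Finset.sum_nonneg hnn)
    have hz := (Finset.sum_eq_zero_iff_of_nonneg hnn).mp h0
    have hvi : v i * v i = 1 := by linarith
    refine ⟨i, ?_⟩
    rcases mul_self_eq_one_iff.mp hvi with h | h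
    · left
      funext j
      by_cases hj : j = i
      · rw [hj, h, eps_apply_self]
      · rw [eps_apply_of_ne hj]
        exact mul_self_eq_zero.mp (hz j (by simp [hj]))
    · right
      funext j
      by_cases hj : j = i
      · rw [hj, h, Pi.neg_apply, eps_apply_self]
      · rw [Pi.neg_apply, eps_apply_of_ne hj, neg_zero]
        exact mul_self_eq_zero.mp (hz j (by simp [hj]))

theorem mem_longRoots_iff {v : FinSpace ℓ} :
    v ∈ longRoots ℓ ↔ IsIntegral v ∧ v ⬝ᵥ v = 2 := by
  constructor
  · rintro ⟨i, j, hij, rfl | rfl | rfl⟩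
    · refine ⟨(IsIntegral.eps i).add (.eps j), ?_⟩
      simp only [add_dotProduct, eps_dotProduct, Pi.add_apply, eps_apply_self,
        eps_apply_of_ne hij, eps_apply_of_ne hij.symm]
      norm_num
    · refine ⟨(IsIntegral.eps i).sub (.eps j), ?_⟩
      simp only [sub_dotProduct, eps_dotProduct, Pi.sub_apply, eps_apply_self,
        eps_apply_of_ne hij, eps_apply_of_ne hij.symm]
      norm_num
    · refine ⟨(IsIntegral.eps i).neg.sub (.eps j), ?_⟩
      simp only [sub_dotProduct, neg_dotProduct, eps_dotProduct, Pi.sub_apply, Pi.neg_apply,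
        eps_apply_self, eps_apply_of_ne hij, eps_apply_of_ne hij.symm]
      norm_num
  · rintro ⟨hv, h2⟩
    have hne : ∃ i, v i ≠ 0 := by
      by_contra! h
      simp [dotProduct, h] at h2
    obtain ⟨i, hi⟩ := hne
    obtain ⟨n, hn⟩ := hv i
    have hle : v i * v i ≤ 2 := by
      rw [← h2]
      exact Finset.single_le_sum (f := fun j => v j * v j) (fun j _ => mul_self_nonneg _)
        (Finset.mem_univ i)
    rw [hn] at hi hle
    have hn0 : n ≠ 0 := by exact_mod_cast hi
    have hn2 : n * n ≤ 2 := by exact_mod_cast hle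
    have hn1 : n = 1 ∨ n = -1 := by
      have : n < 2 := by nlinarith
      have : -2 < n := by nlinarith
      omega
    have hnn : (n : ℚ) * n = 1 := by rcases hn1 with rfl | rfl <;> norm_num
    -- Removing one nonzero coordinate, which is `±1`, leaves an integral vector of norm 1, that is,
    -- a short root.
    have hshort : v - (n : ℚ) • eps i ∈ shortRoots ℓ := by
      rw [mem_shortRoots_iff]
      refine ⟨hv.sub ((IsIntegral.eps i).int_smul n), ?_⟩
      simp only [sub_dotProduct, dotProduct_sub, smul_dotProduct, dotProduct_smul,
        eps_dotProduct, h2, eps_apply_self, dotProduct_comm v (eps i), hn, smul_eq_mul]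
      linarith
    obtain ⟨j, hj⟩ := hshort
    have hij : i ≠ j := by
      rintro rfl
      have hvi : v i - n = 0 := by rw [hn, sub_self]
      rcases hj with hj | hj <;> have := congrFun hj i <;>
        simp [eps_apply_self, hvi] at this
    rcases hn1 with rfl | rfl <;> rcases hj with hj | hj <;> rw [sub_eq_iff_eq_add] at hj
    · exact ⟨i, j, hij, Or.inl (by rw [hj]; simp [add_comm])⟩
    · exact ⟨i, j, hij, Or.inr (Or.inl (by rw [hj]; simp; abel))⟩
    · exact ⟨j, i, hij.symm, Or.inr (Or.inl (by rw [hj]; simp; abel))⟩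
    · exact ⟨i, j, hij, Or.inr (Or.inr (by rw [hj]; simp; abel))⟩

theorem mem_roots_iff {v : FinSpace ℓ} :
    v ∈ roots ℓ ↔ IsIntegral v ∧ (v ⬝ᵥ v = 1 ∨ v ⬝ᵥ v = 2) := by
  rw [roots, Set.mem_union, mem_shortRoots_iff, mem_longRoots_iff]
  tauto

theorem ne_zero_of_mem_roots {v : FinSpace ℓ} (h : v ∈ roots ℓ) : v ≠ 0 := by
  rintro rfl
  have := (mem_roots_iff.mp h).2
  simp at this

theorem neg_mem_roots {v : FinSpace ℓ} (h : v ∈ roots ℓ) : -v ∈ roots ℓ := by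
  rw [mem_roots_iff] at h ⊢
  exact ⟨h.1.neg, by simpa using h.2⟩

theorem simpleRoot_mem_roots (i : Fin ℓ) : simpleRoot i ∈ roots ℓ := by
  unfold simpleRoot
  split_ifs with h
  · refine Or.inr ⟨i, _, ?_, Or.inr (Or.inl rfl)⟩
    intro hi
    have := congrArg Fin.val hi
    simp at this
  · exact Or.inl ⟨i, Or.inl rfl⟩

/-! ### Positivity of roots through coefficients and height -/

theorem coef_sign {v : FinSpace ℓ} (h : v ∈ roots ℓ) :
    (∀ j, 0 ≤ coef j v) ∨ (∀ j, coef j v ≤ 0) := by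
  have hnn : ∀ i j : Fin ℓ, 0 ≤ coef j (eps i) := by
    intro i j
    rw [coef_eps]
    split_ifs <;> norm_num
  have hmono : ∀ i k j : Fin ℓ, i ≤ k → coef j (eps k) ≤ coef j (eps i) := by
    intro i k j hik
    rw [coef_eps, coef_eps]
    split_ifs with h1 h2
    · exact le_rfl
    · exact absurd (hik.trans h1) h2
    · norm_num
    · norm_num
  rcases h with ⟨i, rfl | rfl⟩ | ⟨i, k, -, rfl | rfl | rfl⟩
  · exact Or.inl (hnn i)
  · exact Or.inr fun j => by simpa using hnn i j
  · exact Or.inl fun j => by rw [map_add]; exact add_nonneg (hnn i j) (hnn k j)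
  · rcases le_total i k with hik | hik
    · exact Or.inl fun j => by rw [map_sub]; linarith [hmono i k j hik]
    · exact Or.inr fun j => by rw [map_sub]; linarith [hmono k i j hik]
  · exact Or.inr fun j => by rw [map_sub, map_neg]; linarith [hnn i j, hnn k j]

theorem mem_posRoots_iff_coef {v : FinSpace ℓ} :
    v ∈ posRoots ℓ ↔ v ∈ roots ℓ ∧ ∀ j, 0 ≤ coef j v := by
  constructor
  · rintro ⟨h1, h2⟩
    refine ⟨h1, fun j => ?_⟩
    refine AddSubmonoid.closure_induction (motive := fun v _ => 0 ≤ coef j v) ?_ (by simp) ?_ h2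
    · rintro _ ⟨i, rfl⟩
      rw [coef_simpleRoot]
      split_ifs <;> norm_num
    · intro x y _ _ hx hy
      rw [map_add]
      exact add_nonneg hx hy
  · rintro ⟨h1, h2⟩
    refine ⟨h1, ?_⟩
    rw [← sum_coef_smul v]
    refine AddSubmonoid.sum_mem _ fun j _ => ?_
    obtain ⟨n, hn⟩ := (mem_roots_iff.mp h1).1.coef j
    have hn0 : 0 ≤ n := by exact_mod_cast hn ▸ h2 j
    lift n to ℕ using hn0
    rw [hn, Int.cast_natCast, Nat.cast_smul_eq_nsmul]
    exact AddSubmonoid.nsmul_mem _ (AddSubmonoid.subset_closure (Set.mem_range_self j)) n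

theorem height_ne_zero {v : FinSpace ℓ} (h : v ∈ roots ℓ) : height v ≠ 0 := by
  intro h0
  rw [height_apply] at h0
  apply ne_zero_of_mem_roots h
  rcases coef_sign h with hs | hs
  · rw [Finset.sum_eq_zero_iff_of_nonneg fun j _ => hs j] at h0
    exact eq_zero_of_coef fun j => h0 j (Finset.mem_univ j)
  · rw [Finset.sum_eq_zero_iff_of_nonpos fun j _ => hs j] at h0
    exact eq_zero_of_coef fun j => h0 j (Finset.mem_univ j)

/-- The coefficients of a root all have the same sign, so their sum decides positivity. Positivity
thereby becomes the sign of a linear functional, which composes well with Weyl group elements. -/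
theorem mem_posRoots_iff {v : FinSpace ℓ} :
    v ∈ posRoots ℓ ↔ v ∈ roots ℓ ∧ 0 < height v := by
  rw [mem_posRoots_iff_coef]
  refine and_congr_right fun h => ⟨fun hc => ?_, fun hh => ?_⟩
  · refine lt_of_le_of_ne ?_ (height_ne_zero h).symm
    rw [height_apply]
    exact Finset.sum_nonneg fun j _ => hc j
  · rcases coef_sign h with hs | hs
    · exact hs
    · rw [height_apply] at hh
      exact absurd hh (not_lt.mpr (Finset.sum_nonpos fun j _ => hs j))

theorem mem_posRoots_of_coef_pos {v : FinSpace ℓ} (h : v ∈ roots ℓ) {j : Fin ℓ}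
    (hj : 0 < coef j v) : v ∈ posRoots ℓ := by
  rw [mem_posRoots_iff_coef]
  refine ⟨h, (coef_sign h).resolve_right fun hs => absurd hj (not_lt.mpr (hs j))⟩

theorem neg_mem_posRoots_iff {v : FinSpace ℓ} (h : v ∈ roots ℓ) :
    -v ∈ posRoots ℓ ↔ height v < 0 := by
  rw [mem_posRoots_iff, map_neg, neg_pos]
  exact ⟨fun h => h.2, fun hh => ⟨neg_mem_roots h, hh⟩⟩

theorem simpleRoot_mem_posRoots (i : Fin ℓ) : simpleRoot i ∈ posRoots ℓ :=
  ⟨simpleRoot_mem_roots i, AddSubmonoid.subset_closure (Set.mem_range_self i)⟩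

theorem simpleRoot_mem_posRootsJ {J : Set (Fin ℓ)} {j : Fin ℓ} (hj : j ∈ J) :
    simpleRoot j ∈ posRootsJ J :=
  ⟨simpleRoot_mem_posRoots j, Submodule.subset_span ⟨j, hj, rfl⟩⟩

theorem posRootsJ_univ : posRootsJ (Set.univ : Set (Fin ℓ)) = posRoots ℓ := by
  ext v
  exact ⟨fun h => h.1, fun h => ⟨h, mem_spanJ_iff.mpr fun j hj => absurd (Set.mem_univ j) hj⟩⟩

/-- A coefficient outside `J` is unchanged by `W_J`; a positive one therefore certifies, after any
move by `W_J`, that the root is still positive and outside `Δ_J⁺`. -/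
theorem exists_coef_pos {J : Set (Fin ℓ)} {γ : FinSpace ℓ} (h : γ ∈ posRoots ℓ \ posRootsJ J) :
    ∃ j ∉ J, 0 < coef j γ := by
  have h2 : ¬ ∀ j ∉ J, coef j γ = 0 := fun hc => h.2 ⟨h.1, mem_spanJ_iff.mpr hc⟩
  push Not at h2
  obtain ⟨j, hj, hne⟩ := h2
  exact ⟨j, hj, lt_of_le_of_ne ((mem_posRoots_iff_coef.mp h.1).2 j) hne.symm⟩

/-! ### Reflections and the finite Weyl group -/

/-- Automorphisms of the span of the finite roots. -/
abbrev FinAut (ℓ : ℕ) : Type := FinSpace ℓ ≃ₗ[ℚ] FinSpace ℓ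

theorem reflection_apply (α v : FinSpace ℓ) :
    reflection α v = v - (coroot α ⬝ᵥ v) • α := rfl

theorem coroot_of_mem_shortRoots {α : FinSpace ℓ} (h : α ∈ shortRoots ℓ) :
    coroot α = (2 : ℚ) • α := by
  rw [coroot, (mem_shortRoots_iff.mp h).2]
  norm_num

theorem coroot_of_mem_longRoots {α : FinSpace ℓ} (h : α ∈ longRoots ℓ) : coroot α = α := by
  rw [coroot, (mem_longRoots_iff.mp h).2]
  norm_num

theorem coroot_neg (α : FinSpace ℓ) : coroot (-α) = -coroot α := by
  simp [coroot]

theorem isIntegral_of_mem_roots {α : FinSpace ℓ} (h : α ∈ roots ℓ) : IsIntegral α :=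
  (mem_roots_iff.mp h).1

theorem isIntegral_coroot {α : FinSpace ℓ} (h : α ∈ roots ℓ) : IsIntegral (coroot α) := by
  rcases h with h | h
  · rw [coroot_of_mem_shortRoots h]
    exact_mod_cast (mem_shortRoots_iff.mp h).1.int_smul 2
  · rw [coroot_of_mem_longRoots h]
    exact (mem_longRoots_iff.mp h).1

theorem coroot_dotProduct_pos_iff {α : FinSpace ℓ} (h : α ∈ roots ℓ) (v : FinSpace ℓ) :
    0 < coroot α ⬝ᵥ v ↔ 0 < α ⬝ᵥ v := by
  rcases h with h | h
  · simp [coroot_of_mem_shortRoots h]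
  · rw [coroot_of_mem_longRoots h]

theorem coroot_dotProduct_neg_iff {α : FinSpace ℓ} (h : α ∈ roots ℓ) (v : FinSpace ℓ) :
    coroot α ⬝ᵥ v < 0 ↔ α ⬝ᵥ v < 0 := by
  have := coroot_dotProduct_pos_iff h (-v)
  simpa using this

theorem reflection_self {α : FinSpace ℓ} (h : α ∈ roots ℓ) : reflection α α = -α := by
  rw [reflection_apply, coroot_dotProduct_self (ne_zero_of_mem_roots h)]
  module

theorem reflection_neg (α : FinSpace ℓ) : reflection (-α) = reflection α := by
  ext v
  simp [reflection_apply, coroot_neg]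

theorem reflection_mul_self (α : FinSpace ℓ) : reflection α * reflection α = 1 :=
  LinearEquiv.ext fun v => (reflection α).left_inv v

theorem reflection_reflection (α v : FinSpace ℓ) : reflection α (reflection α v) = v :=
  (reflection α).left_inv v

theorem reflection_inv (α : FinSpace ℓ) : (reflection α)⁻¹ = reflection α :=
  inv_eq_of_mul_eq_one_left (reflection_mul_self α)

theorem reflection_dotProduct (α u v : FinSpace ℓ) :
    reflection α u ⬝ᵥ reflection α v = u ⬝ᵥ v := by
  rw [reflection_apply, reflection_apply]
  by_cases h : α = 0
  · simp [h]
  · have hne : α ⬝ᵥ α ≠ 0 := fun h0 => h (dotProduct_self_eq_zero.mp h0)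
    simp only [coroot, sub_dotProduct, dotProduct_sub, smul_dotProduct, dotProduct_smul,
      smul_eq_mul, dotProduct_comm u α]
    field_simp
    ring

theorem isIntegral_reflection {α v : FinSpace ℓ} (h : α ∈ roots ℓ) (hv : IsIntegral v) :
    IsIntegral (reflection α v) := by
  obtain ⟨n, hn⟩ := (isIntegral_coroot h).dotProduct hv
  rw [reflection_apply, hn]
  exact hv.sub ((isIntegral_of_mem_roots h).int_smul n)

/-- Induction on elements of `W_J`. -/
theorem weylGroupJ_induction {J : Set (Fin ℓ)} {p : FinAut ℓ → Prop} (one : p 1)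
    (mul : ∀ w ∈ weylGroupJ J, ∀ j ∈ J, p w → p (w * reflection (simpleRoot j)))
    {w : FinAut ℓ} (hw : w ∈ weylGroupJ J) : p w := by
  refine Subgroup.closure_induction_right (p := fun w _ => p w) one ?_ ?_ hw
  · rintro x hx _ ⟨j, hj, rfl⟩ h
    exact mul x hx j hj h
  · rintro x hx _ ⟨j, hj, rfl⟩ h
    simp only [reflection_inv]
    exact mul x hx j hj h

theorem weylGroupJ_le (J : Set (Fin ℓ)) : weylGroupJ J ≤ weylGroup ℓ :=
  Subgroup.closure_mono (Set.image_mono (Set.subset_univ J))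

theorem reflection_simpleRoot_mem {J : Set (Fin ℓ)} {j : Fin ℓ} (hj : j ∈ J) :
    reflection (simpleRoot j) ∈ weylGroupJ J :=
  Subgroup.subset_closure ⟨j, hj, rfl⟩

section Weyl

variable {w : FinAut ℓ} (hw : w ∈ weylGroup ℓ)
include hw

theorem weyl_dotProduct (u v : FinSpace ℓ) : w u ⬝ᵥ w v = u ⬝ᵥ v := by
  refine weylGroupJ_induction (p := fun w => ∀ u v, w u ⬝ᵥ w v = u ⬝ᵥ v) (by simp) ?_ hw u v
  intro w _ j _ h u v
  rw [LinearEquiv.mul_apply, LinearEquiv.mul_apply, h, reflection_dotProduct]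

theorem weyl_isIntegral {v : FinSpace ℓ} (hv : IsIntegral v) : IsIntegral (w v) := by
  refine weylGroupJ_induction (p := fun w => ∀ v, IsIntegral v → IsIntegral (w v))
    (by simp) ?_ hw v hv
  intro w _ j _ h v hv
  exact h _ (isIntegral_reflection (simpleRoot_mem_roots j) hv)

theorem weyl_mem_shortRoots {v : FinSpace ℓ} (hv : v ∈ shortRoots ℓ) : w v ∈ shortRoots ℓ := by
  rw [mem_shortRoots_iff] at hv ⊢
  exact ⟨weyl_isIntegral hw hv.1, by rw [weyl_dotProduct hw, hv.2]⟩

theorem weyl_mem_longRoots {v : FinSpace ℓ} (hv : v ∈ longRoots ℓ) : w v ∈ longRoots ℓ := by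
  rw [mem_longRoots_iff] at hv ⊢
  exact ⟨weyl_isIntegral hw hv.1, by rw [weyl_dotProduct hw, hv.2]⟩

theorem weyl_mem_roots {v : FinSpace ℓ} (hv : v ∈ roots ℓ) : w v ∈ roots ℓ :=
  hv.imp (weyl_mem_shortRoots hw) (weyl_mem_longRoots hw)

theorem coroot_weyl (v : FinSpace ℓ) : coroot (w v) = w (coroot v) := by
  rw [coroot, coroot, weyl_dotProduct hw, map_smul]

theorem reflection_weyl (α : FinSpace ℓ) : reflection (w α) = w * reflection α * w⁻¹ := by
  ext1 v
  obtain ⟨u, rfl⟩ := w.surjective v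
  have h1 : w⁻¹ (w u) = u := w.symm_apply_apply u
  rw [LinearEquiv.mul_apply, LinearEquiv.mul_apply, h1, reflection_apply, reflection_apply,
    coroot_weyl hw, weyl_dotProduct hw, map_sub, map_smul]

end Weyl

theorem coef_reflection_simpleRoot {i j : Fin ℓ} (h : i ≠ j) (v : FinSpace ℓ) :
    coef i (reflection (simpleRoot j) v) = coef i v := by
  simp [reflection_apply, coef_simpleRoot, h.symm]

theorem weylGroupJ_coef {J : Set (Fin ℓ)} {w : FinAut ℓ} (hw : w ∈ weylGroupJ J) {i : Fin ℓ}
    (hi : i ∉ J) (v : FinSpace ℓ) : coef i (w v) = coef i v := by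
  refine weylGroupJ_induction (p := fun w => ∀ v, coef i (w v) = coef i v) (by simp) ?_ hw v
  intro w _ j hj h v
  rw [LinearEquiv.mul_apply, h, coef_reflection_simpleRoot]
  rintro rfl
  exact hi hj

theorem weylGroupJ_mem_spanJ {J : Set (Fin ℓ)} {w : FinAut ℓ} (hw : w ∈ weylGroupJ J)
    {v : FinSpace ℓ} (hv : v ∈ spanJ J) : w v ∈ spanJ J := by
  rw [mem_spanJ_iff] at hv ⊢
  intro j hj
  rw [weylGroupJ_coef hw hj, hv j hj]

theorem weylGroupJ_mem_diff {J : Set (Fin ℓ)} {w : FinAut ℓ} (hw : w ∈ weylGroupJ J)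
    {γ : FinSpace ℓ} (h : γ ∈ posRoots ℓ \ posRootsJ J) : w γ ∈ posRoots ℓ \ posRootsJ J := by
  obtain ⟨j, hj, hpos⟩ := exists_coef_pos h
  rw [← weylGroupJ_coef hw hj] at hpos
  exact ⟨mem_posRoots_of_coef_pos (weyl_mem_roots (weylGroupJ_le J hw) h.1.1) hpos,
    fun hc => hpos.ne' (mem_spanJ_iff.mp hc.2 j hj)⟩

theorem reflection_mem_roots {α v : FinSpace ℓ} (h : α ∈ roots ℓ) (hv : v ∈ roots ℓ) :
    reflection α v ∈ roots ℓ := by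
  rw [mem_roots_iff] at hv ⊢
  rw [reflection_dotProduct]
  exact ⟨isIntegral_reflection h hv.1, hv.2⟩

theorem exists_ne_coef_pos {η : FinSpace ℓ} {j : Fin ℓ} (h : η ∈ posRoots ℓ)
    (hne : η ≠ simpleRoot j) : ∃ i ≠ j, 0 < coef i η := by
  have hc := (mem_posRoots_iff_coef.mp h).2
  by_contra! hcon
  have h0 : ∀ i ≠ j, coef i η = 0 := fun i hi => le_antisymm (hcon i hi) (hc i)
  have hη : η = coef j η • simpleRoot j := by
    conv_lhs => rw [← sum_coef_smul η]
    refine Finset.sum_eq_single j (fun i _ hi => ?_) (by simp)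
    rw [h0 i hi, zero_smul]
  obtain ⟨n, hn⟩ := (isIntegral_of_mem_roots h.1).coef j
  have hn0 : 0 ≤ n := by exact_mod_cast hn ▸ hc j
  have hnorm : η ⬝ᵥ η = n * n * (simpleRoot j ⬝ᵥ simpleRoot j) := by
    rw [hn] at hη
    conv_lhs => rw [hη]
    simp only [smul_dotProduct, dotProduct_smul, smul_eq_mul]
    ring
  have h1 : n = 1 := by
    -- The root is `n` times a simple root, so `n²` is a ratio of two norms in `{1, 2}`.
    have hn2 : n * n ≤ 2 ∧ n ≠ 0 := by
      have ha := (mem_roots_iff.mp h.1).2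
      have hb := (mem_roots_iff.mp (simpleRoot_mem_roots j)).2
      constructor
      · have : (n : ℚ) * n ≤ 2 := by
          have := mul_self_nonneg (n : ℚ)
          rcases ha with ha | ha <;> rcases hb with hb | hb <;> rw [ha, hb] at hnorm <;> linarith
        exact_mod_cast this
      · rintro rfl
        rcases ha with ha | ha <;> rw [ha] at hnorm <;> norm_num at hnorm
    have : n < 2 := by nlinarith [hn2.1]
    have := hn2.2
    omega
  apply hne
  rw [hη, hn, h1, Int.cast_one, one_smul]

/-- A simple reflection permutes the positive roots other than the simple root itself. -/
theorem reflection_simpleRoot_mem_posRootsJ {J : Set (Fin ℓ)} {j : Fin ℓ} (hj : j ∈ J)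
    {η : FinSpace ℓ} (h : η ∈ posRootsJ J) (hne : η ≠ simpleRoot j) :
    reflection (simpleRoot j) η ∈ posRootsJ J ∧ reflection (simpleRoot j) η ≠ simpleRoot j := by
  refine ⟨⟨?_, weylGroupJ_mem_spanJ (reflection_simpleRoot_mem hj) h.2⟩, fun heq => ?_⟩
  · obtain ⟨i, hi, hpos⟩ := exists_ne_coef_pos h.1 hne
    rw [← coef_reflection_simpleRoot hi] at hpos
    exact mem_posRoots_of_coef_pos (reflection_mem_roots (simpleRoot_mem_roots j) h.1.1) hpos
  · have h1 := congrArg (reflection (simpleRoot j)) heq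
    rw [reflection_reflection, reflection_self (simpleRoot_mem_roots j)] at h1
    have h2 := (mem_posRoots_iff.mp h.1).2
    have h3 := (mem_posRoots_iff.mp (simpleRoot_mem_posRoots j)).2
    rw [h1, map_neg] at h2
    linarith

/-- Reflections in roots belong to the Weyl group. -/
theorem reflection_mem_weylGroup {γ : FinSpace ℓ} (h : γ ∈ roots ℓ) :
    reflection γ ∈ weylGroup ℓ := by
  have key : ∀ n : ℕ, ∀ γ ∈ posRoots ℓ, height γ < n → reflection γ ∈ weylGroup ℓ := by
    intro n
    induction n with
    | zero =>
      intro γ hγ hlt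
      have := (mem_posRoots_iff.mp hγ).2
      simp only [Nat.cast_zero] at hlt
      linarith
    | succ n ih =>
      intro γ hγ hlt
      by_cases hs : ∃ j, γ = simpleRoot j
      · obtain ⟨j, rfl⟩ := hs
        exact reflection_simpleRoot_mem (Set.mem_univ j)
      push Not at hs
      -- Expanding one factor of `(γ, γ) > 0` in simple roots, some simple root must pair positively
      -- with `γ`; reflecting in it lowers the height by at least 1.
      have hex : ∃ j, 0 < coroot (simpleRoot j) ⬝ᵥ γ := by
        by_contra! hcon
        have hpos : 0 < γ ⬝ᵥ γ := by
          rcases (mem_roots_iff.mp hγ.1).2 with h | h <;> rw [h] <;> norm_num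
        have hexp : γ ⬝ᵥ γ = ∑ j, coef j γ * (simpleRoot j ⬝ᵥ γ) := by
          conv_lhs => rw [← sum_coef_smul γ, sum_dotProduct]
          simp only [smul_dotProduct, sum_coef_smul, smul_eq_mul]
        refine absurd hpos (not_lt.mpr ?_)
        rw [hexp]
        refine Finset.sum_nonpos fun j _ => ?_
        refine mul_nonpos_of_nonneg_of_nonpos ((mem_posRoots_iff_coef.mp hγ).2 j) ?_
        rw [← not_lt, ← coroot_dotProduct_pos_iff (simpleRoot_mem_roots j), not_lt]
        exact hcon j
      obtain ⟨j, hj⟩ := hex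
      have hmem : simpleRoot j ∈ posRoots ℓ := simpleRoot_mem_posRoots j
      obtain ⟨h1, -⟩ := reflection_simpleRoot_mem_posRootsJ (Set.mem_univ j)
        (posRootsJ_univ ▸ hγ) (hs j)
      have hheight : height (reflection (simpleRoot j) γ) < n := by
        obtain ⟨k, hk⟩ := (isIntegral_coroot hmem.1).dotProduct (isIntegral_of_mem_roots hγ.1)
        have hk1 : (1 : ℚ) ≤ k := by
          rw [hk] at hj
          have : 0 < k := by exact_mod_cast hj
          exact_mod_cast this
        have hone : height (simpleRoot j) = 1 := by
          rw [height_apply]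
          simp [coef_simpleRoot]
        rw [reflection_apply, map_sub, map_smul, hone, hk, smul_eq_mul]
        push_cast at hlt
        linarith
      have h2 := ih _ h1.1 hheight
      have hsj : reflection (simpleRoot j) ∈ weylGroup ℓ :=
        reflection_simpleRoot_mem (Set.mem_univ j)
      have h3 := reflection_weyl hsj (reflection (simpleRoot j) γ)
      rw [reflection_reflection] at h3
      rw [h3]
      exact mul_mem (mul_mem hsj h2) (inv_mem hsj)
  have hpos : ∀ γ ∈ posRoots ℓ, reflection γ ∈ weylGroup ℓ := fun γ hγ => by
    obtain ⟨n, hn⟩ := exists_nat_gt (height γ)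
    exact key n γ hγ hn
  rcases lt_or_gt_of_ne (height_ne_zero h) with hh | hh
  · rw [← reflection_neg]
    exact hpos _ ((neg_mem_posRoots_iff h).mpr hh)
  · exact hpos _ (mem_posRoots_iff.mpr ⟨h, hh⟩)

/-! ### The length as the number of inversions -/

theorem posRootsJ_finite (J : Set (Fin ℓ)) : (posRootsJ J).Finite :=
  (roots_finite ℓ).subset fun _ h => h.1.1

/-- `Δ_J⁺` as a `Finset`. -/
noncomputable def posFinset (J : Set (Fin ℓ)) : Finset (FinSpace ℓ) :=
  (posRootsJ_finite J).toFinset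

theorem mem_posFinset {J : Set (Fin ℓ)} {v : FinSpace ℓ} : v ∈ posFinset J ↔ v ∈ posRootsJ J := by
  simp [posFinset]

theorem mem_posFinset_univ {v : FinSpace ℓ} :
    v ∈ posFinset (Set.univ : Set (Fin ℓ)) ↔ v ∈ posRoots ℓ := by
  rw [mem_posFinset, posRootsJ_univ]

/-- The number of roots in `Δ_J⁺` at which `f` is negative. -/
noncomputable def negCount (J : Set (Fin ℓ)) (f : FinSpace ℓ →ₗ[ℚ] ℚ) : ℕ :=
  ((posFinset J).filter fun η => f η < 0).card

/-- The height of the image of a vector under `w`. -/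
def heightComp (w : FinAut ℓ) : FinSpace ℓ →ₗ[ℚ] ℚ := height ∘ₗ w.toLinearMap

theorem heightComp_apply (w : FinAut ℓ) (v : FinSpace ℓ) : heightComp w v = height (w v) := rfl

theorem heightComp_mul (w u : FinAut ℓ) :
    heightComp (w * u) = heightComp w ∘ₗ u.toLinearMap := rfl

/-- The reflection `s_j` permutes `Δ_J⁺` apart from `α_j`, which it negates, so only the
contribution of `α_j` changes. The functional is arbitrary because the construction of `z_ξ` uses
one other than a height. -/
theorem negCount_comp_reflection_add_one {J : Set (Fin ℓ)} {j : Fin ℓ} (hj : j ∈ J)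
    {f : FinSpace ℓ →ₗ[ℚ] ℚ} (hf : f (simpleRoot j) < 0) :
    negCount J (f ∘ₗ (reflection (simpleRoot j)).toLinearMap) + 1 = negCount J f := by
  set s := reflection (simpleRoot j)
  have hmem : simpleRoot j ∈ posFinset J := mem_posFinset.mpr (simpleRoot_mem_posRootsJ hj)
  have hs : s (simpleRoot j) = -simpleRoot j := reflection_self (simpleRoot_mem_roots j)
  have hmaps : ∀ η ∈ (posFinset J).erase (simpleRoot j),
      s η ∈ (posFinset J).erase (simpleRoot j) := by
    intro η hη
    rw [Finset.mem_erase, mem_posFinset] at hη ⊢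
    exact (reflection_simpleRoot_mem_posRootsJ hj hη.2 hη.1).symm
  have hcard : (((posFinset J).erase (simpleRoot j)).filter fun η => f (s η) < 0).card =
      (((posFinset J).erase (simpleRoot j)).filter fun η => f η < 0).card := by
    refine Finset.card_nbij' s s ?_ ?_ ?_ ?_
    · intro η hη
      rw [Finset.mem_coe, Finset.mem_filter] at hη ⊢
      exact ⟨hmaps η hη.1, hη.2⟩
    · intro η hη
      rw [Finset.mem_coe, Finset.mem_filter] at hη ⊢
      exact ⟨hmaps η hη.1, by rw [reflection_reflection]; exact hη.2⟩
    · intro η _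
      exact reflection_reflection _ η
    · intro η _
      exact reflection_reflection _ η
  have h1 : negCount J f =
      (((posFinset J).erase (simpleRoot j)).filter fun η => f η < 0).card + 1 := by
    rw [negCount, ← Finset.insert_erase hmem, Finset.filter_insert, if_pos hf,
      Finset.card_insert_of_notMem (by simp), Finset.insert_erase hmem]
  have h2 : negCount J (f ∘ₗ s.toLinearMap) =
      (((posFinset J).erase (simpleRoot j)).filter fun η => f (s η) < 0).card := by
    have hneg : ¬ (f ∘ₗ s.toLinearMap) (simpleRoot j) < 0 := by
      rw [LinearMap.comp_apply, LinearEquiv.coe_coe, hs, map_neg]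
      linarith
    rw [negCount, ← Finset.insert_erase hmem, Finset.filter_insert, if_neg hneg,
      Finset.insert_erase hmem]
    rfl
  rw [h1, h2, hcard]

theorem comp_reflection_comp_reflection (f : FinSpace ℓ →ₗ[ℚ] ℚ) (α : FinSpace ℓ) :
    (f ∘ₗ (reflection α).toLinearMap) ∘ₗ (reflection α).toLinearMap = f :=
  LinearMap.ext fun v => congrArg f (reflection_reflection α v)

theorem negCount_comp_reflection_of_pos {J : Set (Fin ℓ)} {j : Fin ℓ} (hj : j ∈ J)
    {f : FinSpace ℓ →ₗ[ℚ] ℚ} (hf : 0 < f (simpleRoot j)) :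
    negCount J (f ∘ₗ (reflection (simpleRoot j)).toLinearMap) = negCount J f + 1 := by
  have hneg : (f ∘ₗ (reflection (simpleRoot j)).toLinearMap) (simpleRoot j) < 0 := by
    rw [LinearMap.comp_apply, LinearEquiv.coe_coe, reflection_self (simpleRoot_mem_roots j),
      map_neg]
    linarith
  rw [← negCount_comp_reflection_add_one hj hneg, comp_reflection_comp_reflection]

/-- A functional that is nonnegative on the simple roots is so on the positive roots. -/
theorem nonneg_of_simpleRoot {J : Set (Fin ℓ)} {f : FinSpace ℓ →ₗ[ℚ] ℚ}
    (hf : ∀ j ∈ J, 0 ≤ f (simpleRoot j)) {η : FinSpace ℓ} (h : η ∈ posRootsJ J) : 0 ≤ f η := by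
  rw [← sum_coef_smul η, map_sum]
  refine Finset.sum_nonneg fun j _ => ?_
  rw [map_smul, smul_eq_mul]
  by_cases hj : j ∈ J
  · exact mul_nonneg ((mem_posRoots_iff_coef.mp h.1).2 j) (hf j hj)
  · rw [mem_spanJ_iff.mp h.2 j hj, zero_mul]

/-- Short positive roots are the `ε_i`, so `w` permutes them; positivity of the images of `ε_i -
ε_j` for `i < j` makes the permutation increasing, hence trivial. -/
theorem eq_one_of_posRoots {w : FinAut ℓ} (hw : w ∈ weylGroup ℓ)
    (h : ∀ η ∈ posRoots ℓ, w η ∈ posRoots ℓ) : w = 1 := by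
  have hnn : ∀ i j : Fin ℓ, 0 ≤ coef j (eps i) := by
    intro i j
    rw [coef_eps]
    split_ifs <;> norm_num
  have hepsroot : ∀ i : Fin ℓ, eps i ∈ posRoots ℓ := fun i =>
    mem_posRoots_iff_coef.mpr ⟨Or.inl ⟨i, Or.inl rfl⟩, hnn i⟩
  have hex : ∀ i, ∃ k, w (eps i) = eps k := by
    intro i
    obtain ⟨k, hk | hk⟩ := weyl_mem_shortRoots hw ⟨i, Or.inl rfl⟩
    · exact ⟨k, hk⟩
    · have h1 := (mem_posRoots_iff.mp (h _ (hepsroot i))).2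
      have h2 := (mem_posRoots_iff.mp (hepsroot k)).2
      rw [hk, map_neg] at h1
      linarith
  choose σ hσ using hex
  have hmono : StrictMono σ := by
    intro i j hij
    have hpos : eps i - eps j ∈ posRoots ℓ := by
      refine mem_posRoots_iff_coef.mpr
        ⟨Or.inr ⟨i, j, hij.ne, Or.inr (Or.inl rfl)⟩, fun k => ?_⟩
      rw [map_sub, coef_eps, coef_eps]
      split_ifs with h1 h2 h2
      · norm_num
      · norm_num
      · exact absurd (hij.le.trans h2) h1
      · norm_num
    have h1 := h _ hpos
    rw [map_sub, hσ, hσ] at h1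
    have h2 := (mem_posRoots_iff_coef.mp h1).2 (σ j)
    rw [map_sub, coef_eps, coef_eps, if_pos le_rfl] at h2
    have h3 : σ i ≤ σ j := by
      by_contra hc
      rw [if_neg hc] at h2
      norm_num at h2
    refine lt_of_le_of_ne h3 fun heq => ?_
    rw [heq, sub_self] at h1
    exact ne_zero_of_mem_roots h1.1 rfl
  have hid : σ = id := by
    exact (StrictMono.range_inj hmono strictMono_id).mp (by
      rw [Set.range_id]
      exact (Finite.surjective_of_injective hmono.injective).range_eq)
  ext1 v
  funext i
  have := weyl_dotProduct hw (eps i) v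
  rwa [hσ, hid, id, eps_dotProduct, eps_dotProduct] at this

theorem heightComp_ne_zero {w : FinAut ℓ} (hw : w ∈ weylGroup ℓ) {η : FinSpace ℓ}
    (h : η ∈ roots ℓ) : heightComp w η ≠ 0 :=
  height_ne_zero (weyl_mem_roots hw h)

theorem weyl_mem_posRoots_iff {w : FinAut ℓ} (hw : w ∈ weylGroup ℓ) {η : FinSpace ℓ}
    (h : η ∈ roots ℓ) : w η ∈ posRoots ℓ ↔ 0 < heightComp w η := by
  rw [mem_posRoots_iff, heightComp_apply]
  exact ⟨fun h => h.2, fun hh => ⟨weyl_mem_roots hw h, hh⟩⟩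

theorem neg_weyl_mem_posRoots_iff {w : FinAut ℓ} (hw : w ∈ weylGroup ℓ) {η : FinSpace ℓ}
    (h : η ∈ roots ℓ) : -w η ∈ posRoots ℓ ↔ heightComp w η < 0 :=
  neg_mem_posRoots_iff (weyl_mem_roots hw h)

theorem heightComp_pos_of_simpleRoot {J : Set (Fin ℓ)} {w : FinAut ℓ} (hw : w ∈ weylGroup ℓ)
    (hpos : ∀ j ∈ J, 0 < heightComp w (simpleRoot j)) {η : FinSpace ℓ} (h : η ∈ posRootsJ J) :
    0 < heightComp w η :=
  lt_of_le_of_ne (nonneg_of_simpleRoot (fun j hj => (hpos j hj).le) h)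
    (heightComp_ne_zero hw h.1.1).symm

theorem negCount_prod_le (l : List (Fin ℓ)) :
    (l.map fun i => reflection (simpleRoot i)).prod ∈ weylGroup ℓ ∧
    negCount Set.univ (heightComp (l.map fun i => reflection (simpleRoot i)).prod) ≤ l.length := by
  induction l using List.reverseRecOn with
  | nil =>
    refine ⟨one_mem _, ?_⟩
    simp only [List.map_nil, List.prod_nil, List.length_nil, nonpos_iff_eq_zero, negCount,
      Finset.card_eq_zero, Finset.filter_eq_empty_iff]
    intro η hη
    exact not_lt.mpr (mem_posRoots_iff.mp (mem_posFinset_univ.mp hη)).2.le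
  | append_singleton l i ih =>
    have hs := reflection_simpleRoot_mem (Set.mem_univ i)
    rw [List.map_append, List.prod_append, List.map_singleton, List.prod_singleton,
      List.length_append, List.length_singleton]
    refine ⟨mul_mem ih.1 hs, ?_⟩
    rw [heightComp_mul]
    rcases lt_or_gt_of_ne (heightComp_ne_zero ih.1 (simpleRoot_mem_roots i)) with h | h
    · have := negCount_comp_reflection_add_one (Set.mem_univ i) h
      omega
    · have := negCount_comp_reflection_of_pos (Set.mem_univ i) h
      omega

/-- If `w` has an inversion, it makes some simple root negative, and multiplying by that simple
reflection removes exactly one inversion. -/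
theorem exists_word (n : ℕ) : ∀ w ∈ weylGroup ℓ, negCount Set.univ (heightComp w) = n →
    ∃ l : List (Fin ℓ), l.length = n ∧ (l.map fun i => reflection (simpleRoot i)).prod = w := by
  induction n with
  | zero =>
    intro w hw h0
    refine ⟨[], rfl, (eq_one_of_posRoots hw fun η hη => ?_).symm⟩
    rw [negCount, Finset.card_eq_zero, Finset.filter_eq_empty_iff] at h0
    have := h0 (mem_posFinset_univ.mpr hη)
    exact (weyl_mem_posRoots_iff hw hη.1).mpr
      (lt_of_le_of_ne (not_lt.mp this) (heightComp_ne_zero hw hη.1).symm)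
  | succ n ih =>
    intro w hw hn
    have hex : ∃ j, heightComp w (simpleRoot j) < 0 := by
      by_contra! hc
      have h0 : negCount Set.univ (heightComp w) = 0 := by
        rw [negCount, Finset.card_eq_zero, Finset.filter_eq_empty_iff]
        intro η hη
        exact not_lt.mpr (nonneg_of_simpleRoot (fun j _ => hc j) (mem_posFinset.mp hη))
      omega
    obtain ⟨j, hj⟩ := hex
    have h1 := negCount_comp_reflection_add_one (Set.mem_univ j) hj
    rw [← heightComp_mul] at h1
    obtain ⟨l, hl, hprod⟩ := ih _ (mul_mem hw (reflection_simpleRoot_mem (Set.mem_univ j)))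
      (by omega)
    refine ⟨l ++ [j], by simp [hl], ?_⟩
    rw [List.map_append, List.prod_append, List.map_singleton, List.prod_singleton, hprod,
      mul_assoc, reflection_mul_self, mul_one]

/-- The length of `w` is the number of positive roots made negative by `w`. -/
theorem length_eq_negCount {w : FinAut ℓ} (hw : w ∈ weylGroup ℓ) :
    length w = negCount Set.univ (heightComp w) := by
  refine le_antisymm (Nat.sInf_le (exists_word _ w hw rfl)) ?_
  refine le_csInf ⟨_, exists_word _ w hw rfl⟩ ?_
  rintro n ⟨l, rfl, rfl⟩
  exact (negCount_prod_le l).2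

/-! ### Minimal coset representatives -/

theorem heightComp_pos_of_mem_minReps {J : Set (Fin ℓ)} {w : FinAut ℓ} (hw : w ∈ minReps J)
    {η : FinSpace ℓ} (h : η ∈ posRootsJ J) : 0 < heightComp w η := by
  refine heightComp_pos_of_simpleRoot hw.1 (fun j hj => ?_) h
  by_contra hc
  have hneg := lt_of_le_of_ne (not_lt.mp hc) (heightComp_ne_zero hw.1 (simpleRoot_mem_roots j))
  have h1 := hw.2 _ (reflection_simpleRoot_mem hj)
  rw [length_eq_negCount hw.1, length_eq_negCount (mul_mem hw.1 (weylGroupJ_le J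
    (reflection_simpleRoot_mem hj))), heightComp_mul] at h1
  have h2 := negCount_comp_reflection_add_one (Set.mem_univ j) hneg
  omega

/-- The positive roots outside `Δ_J⁺`. -/
noncomputable def compFinset (J : Set (Fin ℓ)) : Finset (FinSpace ℓ) :=
  posFinset Set.univ \ posFinset J

theorem mem_compFinset {J : Set (Fin ℓ)} {η : FinSpace ℓ} :
    η ∈ compFinset J ↔ η ∈ posRoots ℓ \ posRootsJ J := by
  rw [compFinset, Finset.mem_sdiff, mem_posFinset_univ, mem_posFinset, Set.mem_sdiff]

theorem posFinset_subset (J : Set (Fin ℓ)) : posFinset J ⊆ posFinset Set.univ := fun _ h =>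
  mem_posFinset_univ.mpr (mem_posFinset.mp h).1

/-- `W_J` permutes the positive roots outside `Δ_J⁺`. This gives both the splitting of lengths along
cosets and the `W_J`-invariance of `ρ^∨ - ρ_J^∨`. -/
theorem sum_compFinset_comp {J : Set (Fin ℓ)} {u : FinAut ℓ} (hu : u ∈ weylGroupJ J)
    {M : Type*} [AddCommMonoid M] (g : FinSpace ℓ → M) :
    ∑ η ∈ compFinset J, g (u η) = ∑ η ∈ compFinset J, g η := by
  refine Finset.sum_nbij' u (u⁻¹ : FinAut ℓ) ?_ ?_ ?_ ?_ ?_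
  · intro η hη
    exact mem_compFinset.mpr (weylGroupJ_mem_diff hu (mem_compFinset.mp hη))
  · intro η hη
    exact mem_compFinset.mpr (weylGroupJ_mem_diff (inv_mem hu) (mem_compFinset.mp hη))
  · intro η _
    exact u.symm_apply_apply η
  · intro η _
    exact u.apply_symm_apply η
  · intro η _
    rfl

theorem negCount_univ_eq (J : Set (Fin ℓ)) (f : FinSpace ℓ →ₗ[ℚ] ℚ) :
    negCount Set.univ f = (∑ η ∈ compFinset J, if f η < 0 then 1 else 0) + negCount J f := by
  rw [negCount, negCount, Finset.card_filter, Finset.card_filter, compFinset,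
    Finset.sum_sdiff (posFinset_subset J)]

/-- If `v` maps `Δ_J⁺` into `Δ⁺` and `u ∈ W_J`, the length of `vu` is the length of `v` plus the
number of roots in `Δ_J⁺` made negative by `vu`. -/
theorem length_mul_eq {J : Set (Fin ℓ)} {v u : FinAut ℓ} (hv : v ∈ weylGroup ℓ)
    (hpos : ∀ η ∈ posRootsJ J, 0 < heightComp v η) (hu : u ∈ weylGroupJ J) :
    length (v * u) = length v + negCount J (heightComp (v * u)) := by
  rw [length_eq_negCount hv, length_eq_negCount (mul_mem hv (weylGroupJ_le J hu)),
    negCount_univ_eq J, negCount_univ_eq J (heightComp v)]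
  have h0 : negCount J (heightComp v) = 0 := by
    rw [negCount, Finset.card_eq_zero, Finset.filter_eq_empty_iff]
    intro η hη
    exact not_lt.mpr (hpos η (mem_posFinset.mp hη)).le
  rw [h0, add_zero]
  congr 1
  exact sum_compFinset_comp hu fun η => if heightComp v η < 0 then 1 else 0

theorem minRep_spec (J : Set (Fin ℓ)) (w : FinAut ℓ) :
    (∃ u ∈ weylGroupJ J, minRep J w = w * u) ∧
      ∀ u ∈ weylGroupJ J, length (minRep J w) ≤ length (w * u) :=
  ⟨Function.argminOn_mem length {v | ∃ u ∈ weylGroupJ J, v = w * u}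
      ⟨w, 1, one_mem _, (mul_one w).symm⟩,
    fun u hu => Function.argminOn_le length {v | ∃ u ∈ weylGroupJ J, v = w * u} ⟨u, hu, rfl⟩⟩

theorem minRep_mem_minReps (J : Set (Fin ℓ)) {w : FinAut ℓ} (hw : w ∈ weylGroup ℓ) :
    minRep J w ∈ minReps J := by
  obtain ⟨⟨u, hu, heq⟩, hmin⟩ := minRep_spec J w
  refine ⟨heq ▸ mul_mem hw (weylGroupJ_le J hu), fun u' hu' => ?_⟩
  have := hmin (u * u') (mul_mem hu hu')
  rwa [← mul_assoc, ← heq] at this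

theorem exists_eq_minRep_mul (J : Set (Fin ℓ)) (w : FinAut ℓ) :
    ∃ u ∈ weylGroupJ J, w = minRep J w * u := by
  obtain ⟨⟨u, hu, heq⟩, -⟩ := minRep_spec J w
  exact ⟨u⁻¹, inv_mem hu, by rw [heq, mul_inv_cancel_right]⟩

theorem length_eq_minRep_add {J : Set (Fin ℓ)} {w : FinAut ℓ} (hw : w ∈ weylGroup ℓ) :
    length w = length (minRep J w) + negCount J (heightComp w) := by
  obtain ⟨u, hu, heq⟩ := exists_eq_minRep_mul J w
  have hmem := minRep_mem_minReps J hw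
  have := length_mul_eq hmem.1 (fun η hη => heightComp_pos_of_mem_minReps hmem hη) hu
  rwa [← heq] at this

theorem minRep_mul {J : Set (Fin ℓ)} (w : FinAut ℓ) {u : FinAut ℓ} (hu : u ∈ weylGroupJ J) :
    minRep J (w * u) = minRep J w := by
  have : {v | ∃ u' ∈ weylGroupJ J, v = w * u * u'} = {v | ∃ u' ∈ weylGroupJ J, v = w * u'} := by
    ext v
    constructor
    · rintro ⟨u', hu', rfl⟩
      exact ⟨u * u', mul_mem hu hu', mul_assoc _ _ _⟩
    · rintro ⟨u', hu', rfl⟩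
      exact ⟨u⁻¹ * u', mul_mem (inv_mem hu) hu', by group⟩
  unfold minRep
  simp only [this]

/-! ### Sums over positive coroots and lengths of products with reflections -/

theorem two_mul_halfSumCoroots (J : Set (Fin ℓ)) (v : FinSpace ℓ) :
    2 * (halfSumCoroots (posRootsJ J) ⬝ᵥ v) = ∑ η ∈ posFinset J, coroot η ⬝ᵥ v := by
  rw [halfSumCoroots, finsum_mem_eq_finite_toFinset_sum _ (posRootsJ_finite J), smul_dotProduct,
    sum_dotProduct, smul_eq_mul, posFinset]
  ring

theorem two_mul_rhoCheckJ (J : Set (Fin ℓ)) (v : FinSpace ℓ) :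
    2 * (rhoCheckJ J ⬝ᵥ v) = ∑ η ∈ posFinset J, coroot η ⬝ᵥ v :=
  two_mul_halfSumCoroots J v

theorem two_mul_rhoCheck (v : FinSpace ℓ) :
    2 * (rhoCheck ℓ ⬝ᵥ v) = ∑ η ∈ posFinset Set.univ, coroot η ⬝ᵥ v := by
  rw [← two_mul_halfSumCoroots, posRootsJ_univ, rhoCheck]

theorem two_mul_rhoCheck_sub (J : Set (Fin ℓ)) (v : FinSpace ℓ) :
    2 * ((rhoCheck ℓ - rhoCheckJ J) ⬝ᵥ v) = ∑ η ∈ compFinset J, coroot η ⬝ᵥ v := by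
  rw [sub_dotProduct, mul_sub, two_mul_rhoCheck, two_mul_rhoCheckJ, compFinset,
    ← Finset.sum_sdiff (posFinset_subset J)]
  ring

theorem rhoCheck_sub_dotProduct_weyl {J : Set (Fin ℓ)} {u : FinAut ℓ} (hu : u ∈ weylGroupJ J)
    (v : FinSpace ℓ) :
    (rhoCheck ℓ - rhoCheckJ J) ⬝ᵥ u v = (rhoCheck ℓ - rhoCheckJ J) ⬝ᵥ v := by
  have h : 2 * ((rhoCheck ℓ - rhoCheckJ J) ⬝ᵥ u v) = 2 * ((rhoCheck ℓ - rhoCheckJ J) ⬝ᵥ v) := by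
    rw [two_mul_rhoCheck_sub, two_mul_rhoCheck_sub,
      ← sum_compFinset_comp hu fun η => coroot η ⬝ᵥ u v]
    refine Finset.sum_congr rfl fun η _ => ?_
    rw [coroot_weyl (weylGroupJ_le J hu), weyl_dotProduct (weylGroupJ_le J hu)]
  linarith

/-- The positive roots made negative by `s_γ`. -/
noncomputable def inversions (γ : FinSpace ℓ) : Finset (FinSpace ℓ) :=
  (posFinset Set.univ).filter fun η => height (reflection γ η) < 0

theorem mem_inversions {γ η : FinSpace ℓ} :
    η ∈ inversions γ ↔ η ∈ posRoots ℓ ∧ height (reflection γ η) < 0 := by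
  rw [inversions, Finset.mem_filter, mem_posFinset_univ]

theorem height_reflection (γ η : FinSpace ℓ) :
    height (reflection γ η) = height η - (coroot γ ⬝ᵥ η) * height γ := by
  rw [reflection_apply, map_sub, map_smul, smul_eq_mul]

theorem coroot_dotProduct_pos_comm {α β : FinSpace ℓ} (hα : α ∈ roots ℓ) (hβ : β ∈ roots ℓ) :
    0 < coroot α ⬝ᵥ β ↔ 0 < coroot β ⬝ᵥ α := by
  rw [coroot_dotProduct_pos_iff hα, coroot_dotProduct_pos_iff hβ, dotProduct_comm]

theorem coroot_dotProduct_eq_zero_comm {α β : FinSpace ℓ} (hα : α ∈ roots ℓ)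
    (h : coroot α ⬝ᵥ β = 0) : coroot β ⬝ᵥ α = 0 := by
  have h1 : α ⬝ᵥ β = 0 := by
    rcases hα with hα | hα
    · simpa [coroot_of_mem_shortRoots hα] using h
    · rwa [coroot_of_mem_longRoots hα] at h
  rw [coroot, smul_dotProduct, dotProduct_comm β α, h1, smul_zero]

theorem one_le_coroot_dotProduct {α β : FinSpace ℓ} (hα : α ∈ roots ℓ) (hβ : β ∈ roots ℓ)
    (h : 0 < coroot α ⬝ᵥ β) : 1 ≤ coroot α ⬝ᵥ β := by
  obtain ⟨n, hn⟩ := (isIntegral_coroot hα).dotProduct (isIntegral_of_mem_roots hβ)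
  rw [hn] at h ⊢
  have : 0 < n := by exact_mod_cast h
  exact_mod_cast this

section Reflection

variable {γ : FinSpace ℓ} (hγ : γ ∈ posRoots ℓ)
include hγ

/-- Subtracting `⟨γ^∨, η⟩γ` from `η` can make its height negative only if the coefficient is
positive; the pairing in the other order has the same sign and is an integer. -/
theorem one_le_of_mem_inversions {η : FinSpace ℓ} (h : η ∈ inversions γ) :
    1 ≤ coroot η ⬝ᵥ γ := by
  rw [mem_inversions, height_reflection] at h
  have h1 := (mem_posRoots_iff.mp h.1).2
  have h2 := (mem_posRoots_iff.mp hγ).2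
  refine one_le_coroot_dotProduct h.1.1 hγ.1 ?_
  rw [coroot_dotProduct_pos_comm h.1.1 hγ.1]
  by_contra hc
  have := mul_nonneg (neg_nonneg.mpr (not_lt.mp hc)) h2.le
  linarith

theorem self_mem_inversions : γ ∈ inversions γ := by
  rw [mem_inversions, reflection_self hγ.1, map_neg]
  exact ⟨hγ, neg_neg_of_pos (mem_posRoots_iff.mp hγ).2⟩

theorem neg_reflection_mem_inversions {η : FinSpace ℓ} (h : η ∈ inversions γ) :
    -reflection γ η ∈ inversions γ := by
  rw [mem_inversions] at h ⊢
  refine ⟨(neg_mem_posRoots_iff (reflection_mem_roots hγ.1 h.1.1)).mpr h.2, ?_⟩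
  rw [map_neg, reflection_reflection, map_neg]
  exact neg_neg_of_pos (mem_posRoots_iff.mp h.1).2

omit hγ in
theorem neg_reflection_neg_reflection (η : FinSpace ℓ) :
    -reflection γ (-reflection γ η) = η := by
  rw [map_neg, reflection_reflection, neg_neg]

theorem sum_inversions_comp {M : Type*} [AddCommMonoid M] (g : FinSpace ℓ → M) :
    ∑ η ∈ inversions γ, g (-reflection γ η) = ∑ η ∈ inversions γ, g η :=
  Finset.sum_nbij' (fun η => -reflection γ η) (fun η => -reflection γ η)
    (fun _ h => neg_reflection_mem_inversions hγ h)
    (fun _ h => neg_reflection_mem_inversions hγ h)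
    (fun η _ => neg_reflection_neg_reflection η)
    (fun η _ => neg_reflection_neg_reflection η) (fun _ _ => rfl)

theorem sum_not_inversions_comp {M : Type*} [AddCommMonoid M] (g : FinSpace ℓ → M) :
    ∑ η ∈ posFinset Set.univ \ inversions γ, g (reflection γ η) =
      ∑ η ∈ posFinset Set.univ \ inversions γ, g η := by
  have hmem : ∀ η ∈ posFinset Set.univ \ inversions γ,
      reflection γ η ∈ posFinset Set.univ \ inversions γ := by
    intro η hη
    rw [Finset.mem_sdiff, mem_posFinset_univ, mem_inversions] at hη ⊢
    have hr := reflection_mem_roots hγ.1 hη.1.1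
    have hnn : 0 ≤ height (reflection γ η) := not_lt.mp fun hc => hη.2 ⟨hη.1, hc⟩
    refine ⟨mem_posRoots_iff.mpr ⟨hr, lt_of_le_of_ne hnn (height_ne_zero hr).symm⟩, ?_⟩
    rintro ⟨-, hc⟩
    rw [reflection_reflection] at hc
    exact absurd hc (not_lt.mpr (mem_posRoots_iff.mp hη.1).2.le)
  exact Finset.sum_nbij' (reflection γ) (reflection γ) hmem hmem
    (fun η _ => reflection_reflection γ η) (fun η _ => reflection_reflection γ η) (fun _ _ => rfl)

omit hγ in
theorem sum_posFinset_eq (γ : FinSpace ℓ) {M : Type*} [AddCommMonoid M] (g : FinSpace ℓ → M) :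
    ∑ η ∈ posFinset Set.univ, g η =
      ∑ η ∈ posFinset Set.univ \ inversions γ, g η + ∑ η ∈ inversions γ, g η :=
  (Finset.sum_sdiff (Finset.filter_subset _ _)).symm

theorem coroot_reflection_dotProduct (η : FinSpace ℓ) :
    coroot (reflection γ η) ⬝ᵥ γ = -(coroot η ⬝ᵥ γ) := by
  rw [coroot_weyl (reflection_mem_weylGroup hγ.1), ← reflection_dotProduct γ,
    reflection_reflection, reflection_self hγ.1, dotProduct_neg]

/-- On the positive roots that stay positive, `s_γ` acts as a permutation negating the pairing with
`γ`, so these terms cancel. -/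
theorem two_mul_rhoCheck_eq_sum_inversions :
    2 * (rhoCheck ℓ ⬝ᵥ γ) = ∑ η ∈ inversions γ, coroot η ⬝ᵥ γ := by
  rw [two_mul_rhoCheck, sum_posFinset_eq γ]
  have h := sum_not_inversions_comp hγ fun η => coroot η ⬝ᵥ γ
  simp only [coroot_reflection_dotProduct hγ, Finset.sum_neg_distrib] at h
  linarith

/-- The sign of the root `wη`. -/
def rootSign (w : FinAut ℓ) (η : FinSpace ℓ) : ℚ := if 0 < heightComp w η then 1 else -1

omit hγ in
theorem neg_one_le_rootSign (w : FinAut ℓ) (η : FinSpace ℓ) : -1 ≤ rootSign w η := by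
  unfold rootSign
  split_ifs <;> norm_num

/-- Positive roots kept positive by `s_γ` are permuted and cancel in the difference of inversion
counts. On the others, reindexing by the involution `η ↦ -s_γ η` turns the condition `w s_γ η < 0`
into `wη > 0`. -/
theorem length_mul_reflection_sub {w : FinAut ℓ} (hw : w ∈ weylGroup ℓ) :
    (length (w * reflection γ) : ℚ) - length w = ∑ η ∈ inversions γ, rootSign w η := by
  have hws := mul_mem hw (reflection_mem_weylGroup hγ.1)
  rw [length_eq_negCount hw, length_eq_negCount hws, negCount, negCount, Finset.card_filter,
    Finset.card_filter]
  push_cast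
  rw [sum_posFinset_eq γ, sum_posFinset_eq γ fun η => if heightComp w η < 0 then (1 : ℚ) else 0]
  have h1 := sum_not_inversions_comp hγ fun η => if heightComp w η < 0 then (1 : ℚ) else 0
  have h2 := sum_inversions_comp hγ fun η =>
    if heightComp (w * reflection γ) η < 0 then (1 : ℚ) else 0
  have h3 : ∀ η, heightComp (w * reflection γ) η = heightComp w (reflection γ η) := fun _ => rfl
  simp only [h3, map_neg, reflection_reflection] at h2 ⊢
  rw [h1, ← h2, add_sub_add_left_eq_sub, ← Finset.sum_sub_distrib]
  refine Finset.sum_congr rfl fun η hη => ?_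
  have hne := heightComp_ne_zero hw (mem_inversions.mp hη).1.1
  unfold rootSign
  rcases lt_or_gt_of_ne hne with h | h
  · rw [if_neg (by linarith), if_pos h, if_neg (by linarith)]
    norm_num
  · rw [if_pos (by linarith), if_neg (by linarith), if_pos h]
    norm_num

/-- Pair `η` with `-s_γ η`: their sum is a positive multiple of `γ`, so when `wγ` is negative the
two signs cannot both be `+1`. The pair at `η = γ` contributes `-2`. -/
theorem length_mul_reflection_lt {w : FinAut ℓ} (hw : w ∈ weylGroup ℓ)
    (hneg : heightComp w γ < 0) : length (w * reflection γ) < length w := by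
  have h1 := length_mul_reflection_sub hγ hw
  have h2 := sum_inversions_comp hγ (rootSign w)
  have h3 : ∑ η ∈ inversions γ, (rootSign w η + rootSign w (-reflection γ η)) < 0 := by
    rw [← Finset.sum_const_zero (s := inversions γ)]
    refine Finset.sum_lt_sum (fun η hη => ?_) ⟨γ, self_mem_inversions hγ, ?_⟩
    · have hc := one_le_of_mem_inversions hγ hη
      have hc' : 0 < coroot γ ⬝ᵥ η := by
        rw [coroot_dotProduct_pos_comm hγ.1 (mem_inversions.mp hη).1.1]
        linarith
      have hsum : heightComp w η + heightComp w (-reflection γ η) < 0 := by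
        rw [← map_add, reflection_apply, neg_sub, add_sub_cancel, map_smul, smul_eq_mul]
        exact mul_neg_of_pos_of_neg hc' hneg
      unfold rootSign
      split_ifs with ha hb
      · linarith
      all_goals norm_num
    · have : -reflection γ γ = γ := by rw [reflection_self hγ.1, neg_neg]
      rw [this, rootSign, if_neg (by linarith)]
      norm_num
  rw [Finset.sum_add_distrib, h2] at h3
  have : (length (w * reflection γ) : ℚ) < length w := by linarith
  exact_mod_cast this

theorem length_mul_reflection_add {w : FinAut ℓ} (hw : w ∈ weylGroup ℓ) :
    (length (w * reflection γ) : ℚ) - length w + 2 * (rhoCheck ℓ ⬝ᵥ γ) =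
      ∑ η ∈ inversions γ, (coroot η ⬝ᵥ γ + rootSign w η) := by
  rw [length_mul_reflection_sub hγ hw, two_mul_rhoCheck_eq_sum_inversions hγ,
    Finset.sum_add_distrib, add_comm]

/-- The left side is at least 3: one copy of `2⟨ρ^∨, γ⟩` together with the length difference is at
least 1, and the other copy is at least 2, as seen from the term `η = γ` in sums of nonnegative
terms. -/
theorem length_mul_reflection_add_four_ne {w : FinAut ℓ} (hw : w ∈ weylGroup ℓ) :
    (length (w * reflection γ) : ℚ) - length w + 4 * (rhoCheck ℓ ⬝ᵥ γ) ≠ 1 := by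
  have h1 := length_mul_reflection_add hγ hw
  have h2 := two_mul_rhoCheck_eq_sum_inversions hγ
  have hγγ := coroot_dotProduct_self (ne_zero_of_mem_roots hγ.1)
  have h3 : coroot γ ⬝ᵥ γ + rootSign w γ ≤
      ∑ η ∈ inversions γ, (coroot η ⬝ᵥ γ + rootSign w η) :=
    Finset.single_le_sum (f := fun η => coroot η ⬝ᵥ γ + rootSign w η)
      (fun η hη => by linarith [one_le_of_mem_inversions hγ hη, neg_one_le_rootSign w η])
      (self_mem_inversions hγ)
  have h4 : coroot γ ⬝ᵥ γ ≤ ∑ η ∈ inversions γ, coroot η ⬝ᵥ γ :=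
    Finset.single_le_sum (f := fun η => coroot η ⬝ᵥ γ)
      (fun η hη => by linarith [one_le_of_mem_inversions hγ hη]) (self_mem_inversions hγ)
  have h5 := neg_one_le_rootSign w γ
  intro h
  linarith

end Reflection

/-! ### Edges of the quantum Bruhat graph -/

section Edges

variable {J : Set (Fin ℓ)} {w : FinAut ℓ} {γ : FinSpace ℓ} (hw : w ∈ minReps J)
  (hγ : γ ∈ posRoots ℓ \ posRootsJ J)
include hw hγ

/-- Write `w s_γ = vu` with `v` minimal and `u ∈ W_J`. Then `v s_{uγ} = w u⁻¹`, and `v` makes the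
positive root `uγ` negative, so `ℓ(w u⁻¹) < ℓ(v) = ℓ(w) + 1`. Hence `w u⁻¹` has no inversion in
`Δ_J⁺`, and minimality of `w` forces `u = 1`. -/
theorem heightComp_pos_of_bruhatEdge
    (hlen : length (minRep J (w * reflection γ)) = length w + 1) :
    0 < heightComp w γ ∧ ∀ η ∈ posRootsJ J, 0 < heightComp (w * reflection γ) η := by
  have hws := mul_mem hw.1 (reflection_mem_weylGroup hγ.1.1)
  have hpos : 0 < heightComp w γ := by
    refine lt_of_le_of_ne (not_lt.mp fun hc => ?_) (heightComp_ne_zero hw.1 hγ.1.1).symm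
    have h1 := length_mul_reflection_lt hγ.1 hw.1 hc
    have h2 := length_eq_minRep_add (J := J) hws
    omega
  refine ⟨hpos, ?_⟩
  obtain ⟨u, hu, heq⟩ := exists_eq_minRep_mul J (w * reflection γ)
  have hv := minRep_mem_minReps J hws
  set v := minRep J (w * reflection γ)
  have huW := weylGroupJ_le J hu
  have huγ := weylGroupJ_mem_diff hu hγ
  have hvneg : heightComp v (u γ) < 0 := by
    have h1 : v (u γ) = -w γ := by
      rw [← LinearEquiv.mul_apply, ← heq, LinearEquiv.mul_apply, reflection_self hγ.1.1, map_neg]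
    rw [heightComp_apply, h1, map_neg]
    exact neg_neg_of_pos hpos
  have hlt := length_mul_reflection_lt huγ.1 hv.1 hvneg
  have hprod : v * reflection (u γ) = w * u⁻¹ := by
    rw [reflection_weyl huW, ← mul_assoc, ← mul_assoc, ← heq, mul_assoc w, reflection_mul_self,
      mul_one]
  rw [hprod, length_mul_eq hw.1 (fun η hη => heightComp_pos_of_mem_minReps hw hη) (inv_mem hu),
    hlen] at hlt
  have hzero : negCount J (heightComp (w * u⁻¹)) = 0 := by omega
  rw [negCount, Finset.card_eq_zero, Finset.filter_eq_empty_iff] at hzero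
  have hone : u⁻¹ = 1 := by
    refine eq_one_of_posRoots (inv_mem huW) fun η hη => ?_
    by_cases hJ : η ∈ posRootsJ J
    · have hr := weyl_mem_roots (inv_mem huW) hη.1
      by_contra hc
      rw [mem_posRoots_iff, not_and, not_lt] at hc
      have hneg := (neg_mem_posRoots_iff hr).mpr (lt_of_le_of_ne (hc hr) (height_ne_zero hr))
      have h1 := heightComp_pos_of_mem_minReps hw
        ⟨hneg, neg_mem (weylGroupJ_mem_spanJ (inv_mem hu) hJ.2)⟩
      rw [map_neg] at h1
      have h2 : ¬ heightComp w (u⁻¹ η) < 0 := hzero (mem_posFinset.mpr hJ)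
      linarith
    · exact (weylGroupJ_mem_diff (inv_mem hu) ⟨hη, hJ⟩).1
  rw [inv_eq_one.mp hone, mul_one] at heq
  intro η hη
  rw [heq]
  exact heightComp_pos_of_mem_minReps hv hη

/-- The edge condition equates the sum of `f ≥ 0` over the inversions of `s_γ` with `1 + ∑ g` over
`Δ_J⁺`. The roots `η ∈ Δ_J⁺` with `⟨η^∨, γ⟩ > 0` form `S`; they and their partners `-s_γ η` are
distinct inversions other than `γ`, and each pair contributes `2g(η)`. With `f(γ) ≥ 1` this yields
`∑_S g ≤ ∑_{Δ_J⁺ \ S} g`. But `g > 0` on `S` and `g ≤ 0` off it, so `S` is empty and `g` vanishes on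
`Δ_J⁺`, which is the claim. -/
theorem heightComp_of_quantumEdge
    (hlen : (length (minRep J (w * reflection γ)) : ℚ) =
      length w - 2 * ((rhoCheck ℓ - rhoCheckJ J) ⬝ᵥ γ) + 1) {η : FinSpace ℓ}
    (hη : η ∈ posRootsJ J) :
    (coroot η ⬝ᵥ γ = 0 ∧ 0 < heightComp (w * reflection γ) η) ∨
      (coroot η ⬝ᵥ γ = -1 ∧ heightComp (w * reflection γ) η < 0) := by
  classical
  have hws := mul_mem hw.1 (reflection_mem_weylGroup hγ.1.1)
  let f : FinSpace ℓ → ℚ := fun η => coroot η ⬝ᵥ γ + rootSign w η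
  let g : FinSpace ℓ → ℚ := fun η =>
    coroot η ⬝ᵥ γ + if heightComp (w * reflection γ) η < 0 then 1 else 0
  let m : FinSpace ℓ → FinSpace ℓ := fun η => -reflection γ η
  have hmm : ∀ η, m (m η) = η := neg_reflection_neg_reflection
  let S := (posFinset J).filter fun η => 0 < coroot η ⬝ᵥ γ
  have hsum : ∑ η ∈ inversions γ, f η = 1 + ∑ η ∈ posFinset J, g η := by
    have h1 := length_mul_reflection_add hγ.1 hw.1
    have h2 := length_eq_minRep_add (J := J) hws
    have h3 := two_mul_rhoCheckJ J γ
    have h4 : (negCount J (heightComp (w * reflection γ)) : ℚ) = ∑ η ∈ posFinset J,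
        if heightComp (w * reflection γ) η < 0 then (1 : ℚ) else 0 := by
      rw [negCount, Finset.card_filter]
      push_cast
      rfl
    rw [← h1, h2, Finset.sum_add_distrib, ← h3, ← h4]
    push_cast
    rw [hlen, sub_dotProduct]
    ring
  have hγγ := coroot_dotProduct_self (ne_zero_of_mem_roots hγ.1.1)
  have hSJ : ∀ η ∈ S, η ∈ posRootsJ J ∧ 0 < coroot η ⬝ᵥ γ := fun η hη => by
    rwa [Finset.mem_filter, mem_posFinset] at hη
  obtain ⟨j, hj, hγj⟩ := exists_coef_pos hγ
  have hSγ : ∀ η ∈ S, coef j (m η) = (coroot γ ⬝ᵥ η) * coef j γ ∧ 0 < coroot γ ⬝ᵥ η := by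
    intro η hη
    obtain ⟨h1, h2⟩ := hSJ η hη
    refine ⟨?_, (coroot_dotProduct_pos_comm h1.1.1 hγ.1.1).mp h2⟩
    simp only [m, reflection_apply, map_neg, map_sub, map_smul, smul_eq_mul,
      mem_spanJ_iff.mp h1.2 j hj]
    ring
  have hSinv : ∀ η ∈ S, η ∈ inversions γ := by
    intro η hη
    obtain ⟨h1, h2⟩ := hSγ η hη
    have hr := reflection_mem_roots hγ.1.1 (hSJ η hη).1.1.1
    rw [mem_inversions, ← neg_mem_posRoots_iff hr]
    exact ⟨(hSJ η hη).1.1, mem_posRoots_of_coef_pos (neg_mem_roots hr)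
      (h1 ▸ mul_pos h2 hγj)⟩
  -- Elements of `S` have zero coefficient at `j ∉ J`, whereas their partners have a positive one
  -- inherited from `γ`.
  have hdisj : Disjoint S (S.image m) := by
    rw [Finset.disjoint_left]
    intro η hη hη'
    obtain ⟨ζ, hζ, rfl⟩ := Finset.mem_image.mp hη'
    obtain ⟨h1, h2⟩ := hSγ ζ hζ
    rw [mem_spanJ_iff.mp (hSJ _ hη).1.2 j hj] at h1
    exact (mul_pos h2 hγj).ne h1
  have hγS : γ ∉ S ∪ S.image m := by
    have hγS' : γ ∉ S := fun hc => hγ.2 (hSJ γ hc).1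
    rw [Finset.mem_union, not_or]
    refine ⟨hγS', fun hc => ?_⟩
    obtain ⟨ζ, hζ, heq⟩ := Finset.mem_image.mp hc
    have h1 := hmm ζ
    have h2 : m γ = γ := by simp only [m, reflection_self hγ.1.1, neg_neg]
    rw [heq, h2] at h1
    exact hγS' (h1 ▸ hζ)
  have hle : ∑ η ∈ insert γ (S ∪ S.image m), f η ≤ ∑ η ∈ inversions γ, f η := by
    refine Finset.sum_le_sum_of_subset_of_nonneg ?_ fun η hη _ => ?_
    · intro η hη
      rcases Finset.mem_insert.mp hη with rfl | hη
      · exact self_mem_inversions hγ.1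
      rcases Finset.mem_union.mp hη with hη | hη
      · exact hSinv η hη
      · obtain ⟨ζ, hζ, rfl⟩ := Finset.mem_image.mp hη
        exact neg_reflection_mem_inversions hγ.1 (hSinv ζ hζ)
    · have h1 := one_le_of_mem_inversions hγ.1 hη
      have h2 := neg_one_le_rootSign w η
      change 0 ≤ coroot η ⬝ᵥ γ + rootSign w η
      linarith
  have hpair : ∀ η ∈ S, f η + f (m η) = 2 * g η := by
    -- Minimality of `w` gives `wη` the sign `+1`, and the partner's sign is opposite to that of `w
    -- s_γ η`; the signs add up to 2 or 0.
    intro η hη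
    have h1 : rootSign w η = 1 := by
      rw [rootSign, if_pos (heightComp_pos_of_mem_minReps hw (hSJ η hη).1)]
    have h2 : coroot (m η) ⬝ᵥ γ = coroot η ⬝ᵥ γ := by
      simp only [m]
      rw [coroot_neg, neg_dotProduct, coroot_reflection_dotProduct hγ.1, neg_neg]
    have h3 : heightComp w (m η) = -heightComp (w * reflection γ) η := by
      simp only [m]
      rw [map_neg]
      rfl
    simp only [f, g]
    rw [h1, h2, rootSign, h3]
    simp only [neg_pos]
    split_ifs <;> ring
  have hfγ : 1 ≤ f γ := by
    have := neg_one_le_rootSign w γ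
    change 1 ≤ coroot γ ⬝ᵥ γ + rootSign w γ
    linarith
  rw [Finset.sum_insert hγS, Finset.sum_union hdisj,
    Finset.sum_image (fun a _ b _ hab => by rw [← hmm a, hab, hmm b]), ← Finset.sum_add_distrib,
    Finset.sum_congr rfl hpair, ← Finset.mul_sum, hsum,
    ← Finset.sum_filter_add_sum_filter_not (posFinset J) fun η => 0 < coroot η ⬝ᵥ γ] at hle
  have hrest : ∀ η ∈ (posFinset J).filter (fun η => ¬ 0 < coroot η ⬝ᵥ γ), g η ≤ 0 ∧
      (g η = 0 → (coroot η ⬝ᵥ γ = 0 ∧ 0 < heightComp (w * reflection γ) η) ∨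
        (coroot η ⬝ᵥ γ = -1 ∧ heightComp (w * reflection γ) η < 0)) := by
    intro η hη
    rw [Finset.mem_filter, mem_posFinset, not_lt] at hη
    obtain ⟨hJ, hc⟩ := hη
    simp only [g]
    rcases hc.lt_or_eq with hc | hc
    · have h1 : coroot η ⬝ᵥ γ ≤ -1 := by
        have := one_le_coroot_dotProduct hJ.1.1 (neg_mem_roots hγ.1.1)
          (by rw [dotProduct_neg]; linarith)
        rw [dotProduct_neg] at this
        linarith
      split_ifs with h2
      · exact ⟨by linarith, fun h3 => Or.inr ⟨by linarith, h2⟩⟩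
      · exact ⟨by linarith, fun h3 => by linarith⟩
    · have h1 : 0 < heightComp (w * reflection γ) η := by
        have h2 := heightComp_pos_of_mem_minReps hw hJ
        have h3 : reflection γ η = η := by
          rw [reflection_apply, coroot_dotProduct_eq_zero_comm hJ.1.1 hc, zero_smul, sub_zero]
        rwa [heightComp_apply, LinearEquiv.mul_apply, h3]
      rw [if_neg (not_lt.mpr h1.le), hc]
      exact ⟨by norm_num, fun _ => Or.inl ⟨rfl, h1⟩⟩
  have hgS : ∀ η ∈ S, 0 < g η := by
    intro η hη
    have := (hSJ η hη).2
    simp only [g]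
    split_ifs <;> linarith
  have hr0 := Finset.sum_nonpos fun η hη => (hrest η hη).1
  have hS0 := Finset.sum_nonneg fun η hη => (hgS η hη).le
  by_cases hηS : 0 < coroot η ⬝ᵥ γ
  · have hmem : η ∈ S := Finset.mem_filter.mpr ⟨mem_posFinset.mpr hη, hηS⟩
    have : 0 < ∑ η ∈ S, g η := Finset.sum_pos hgS ⟨η, hmem⟩
    change 0 < ∑ η ∈ (posFinset J).filter (fun η => 0 < coroot η ⬝ᵥ γ), g η at this
    linarith
  · have hmem : η ∈ (posFinset J).filter (fun η => ¬ 0 < coroot η ⬝ᵥ γ) :=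
      Finset.mem_filter.mpr ⟨mem_posFinset.mpr hη, hηS⟩
    have hz : ∑ η ∈ (posFinset J).filter (fun η => ¬ 0 < coroot η ⬝ᵥ γ), g η = 0 := by
      change 0 ≤ ∑ η ∈ (posFinset J).filter (fun η => 0 < coroot η ⬝ᵥ γ), g η at hS0
      linarith
    rw [Finset.sum_eq_zero_iff_of_nonpos fun η hη => (hrest η hη).1] at hz
    exact (hrest η hmem).2 (hz η hmem)

end Edges

/-! ### The affine Weyl group -/

/-- Automorphisms of the span of the affine real roots. -/
abbrev AffAut (ℓ : ℕ) : Type := AffSpace ℓ ≃ₗ[ℚ] AffSpace ℓ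

theorem incl_apply (w : FinAut ℓ) (x : AffSpace ℓ) : incl w x = (w x.1, x.2) := rfl

theorem transl_apply (ξ : FinSpace ℓ) (x : AffSpace ℓ) :
    transl ξ x = (x.1, x.2 - x.1 ⬝ᵥ ξ) := rfl

theorem affReflection_apply (β x : AffSpace ℓ) :
    affReflection β x = x - (coroot β.1 ⬝ᵥ x.1) • β := rfl

theorem incl_mul_transl_apply (w : FinAut ℓ) (ξ : FinSpace ℓ) (x : AffSpace ℓ) :
    (incl w * transl ξ) x = (w x.1, x.2 - x.1 ⬝ᵥ ξ) := rfl

theorem incl_mul (w u : FinAut ℓ) : incl (w * u) = incl w * incl u := rfl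

theorem transl_zero : transl (0 : FinSpace ℓ) = 1 := by
  ext1 x
  simp [transl_apply]

theorem transl_add (ξ ζ : FinSpace ℓ) : transl (ξ + ζ) = transl ξ * transl ζ := by
  ext1 x
  rw [LinearEquiv.mul_apply]
  simp only [transl_apply, dotProduct_add, Prod.mk.injEq, true_and]
  ring

theorem transl_mul_incl {w : FinAut ℓ} (hw : w ∈ weylGroup ℓ) (ξ : FinSpace ℓ) :
    transl ξ * incl w = incl w * transl ((w⁻¹ : FinAut ℓ) ξ) := by
  ext1 x
  obtain ⟨ζ, rfl⟩ := w.surjective ξ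
  have h : (w⁻¹ : FinAut ℓ) (w ζ) = ζ := w.symm_apply_apply ζ
  rw [LinearEquiv.mul_apply, incl_mul_transl_apply, h, incl_apply, transl_apply]
  simp only [weyl_dotProduct hw]

theorem affReflection_eq (α : FinSpace ℓ) (n : ℚ) :
    affReflection (α, n) = incl (reflection α) * transl (n • coroot α) := by
  ext1 x
  rw [incl_mul_transl_apply, affReflection_apply, reflection_apply]
  ext1
  · rfl
  · simp only [Prod.snd_sub, Prod.smul_snd, smul_eq_mul, dotProduct_smul,
      dotProduct_comm (coroot α)]
    ring

theorem coroot_two_smul (α : FinSpace ℓ) :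
    coroot ((2 : ℚ) • α) = (1 / 2 : ℚ) • coroot α := by
  simp only [coroot, smul_dotProduct, dotProduct_smul, smul_smul, smul_eq_mul]
  congr 1
  by_cases h : α ⬝ᵥ α = 0
  · simp [h]
  · field_simp

theorem reflection_two_smul (α : FinSpace ℓ) : reflection ((2 : ℚ) • α) = reflection α := by
  ext1 v
  rw [reflection_apply, reflection_apply, coroot_two_smul, smul_dotProduct, smul_smul, smul_eq_mul]
  congr 2
  ring

/-- Doubling the root halves the coroot, and `α^∨ = 2α` for `α` short; the translation is thus by
`α` itself rather than `2α`. -/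
theorem affReflection_two_smul {α : FinSpace ℓ} (h : α ∈ shortRoots ℓ) :
    affReflection ((2 : ℚ) • α, (1 : ℚ)) = incl (reflection α) * transl α := by
  rw [affReflection_eq, reflection_two_smul, coroot_two_smul, coroot_of_mem_shortRoots h,
    smul_smul, smul_smul]
  norm_num

theorem affReflection_mul_incl {w : FinAut ℓ} (hw : w ∈ weylGroup ℓ) (γ : FinSpace ℓ) (n : ℚ) :
    affReflection (w γ, n) * incl w = incl (w * reflection γ) * transl (n • coroot γ) := by
  have h : (w⁻¹ : FinAut ℓ) (w (coroot γ)) = coroot γ := w.symm_apply_apply _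
  rw [affReflection_eq, mul_assoc, transl_mul_incl hw, coroot_weyl hw, map_smul, h, ← mul_assoc,
    ← incl_mul, reflection_weyl hw, inv_mul_cancel_right]

theorem affReflection_two_smul_mul_incl {w : FinAut ℓ} (hw : w ∈ weylGroup ℓ) {γ : FinSpace ℓ}
    (hγ : γ ∈ shortRoots ℓ) :
    affReflection ((2 : ℚ) • w γ, (1 : ℚ)) * incl w = incl (w * reflection γ) * transl γ := by
  have h : (w⁻¹ : FinAut ℓ) (w γ) = γ := w.symm_apply_apply _
  rw [affReflection_two_smul (weyl_mem_shortRoots hw hγ), mul_assoc, transl_mul_incl hw, h,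
    ← mul_assoc, ← incl_mul, reflection_weyl hw, inv_mul_cancel_right]

theorem affReflection_mem {β : AffSpace ℓ} (h : β ∈ affRoots ℓ) :
    affReflection β ∈ affWeylGroup ℓ :=
  Subgroup.subset_closure ⟨β, h, rfl⟩

theorem incl_mem_affWeylGroup {w : FinAut ℓ} (hw : w ∈ weylGroup ℓ) :
    incl w ∈ affWeylGroup ℓ := by
  refine weylGroupJ_induction (p := fun w => incl w ∈ affWeylGroup ℓ) (one_mem _) ?_ hw
  intro w _ j _ h
  rw [incl_mul]
  refine mul_mem h ?_
  have h1 := affReflection_eq (simpleRoot j) 0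
  rw [zero_smul, transl_zero, mul_one] at h1
  rw [← h1]
  exact affReflection_mem (Or.inl ⟨_, simpleRoot_mem_roots j, 0, by simp⟩)

/-- For either root length `s_α t_α` is an affine reflection: in `2α + δ` for `α` short, in `α + δ`
for `α` long. -/
theorem transl_mem_affWeylGroup {ξ : FinSpace ℓ} (h : ξ ∈ rootLattice ℓ) :
    transl ξ ∈ affWeylGroup ℓ := by
  refine AddSubgroup.closure_induction (p := fun ξ _ => transl ξ ∈ affWeylGroup ℓ) ?_ ?_ ?_ ?_ h
  · intro α hα
    have h1 := incl_mem_affWeylGroup (reflection_mem_weylGroup hα)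
    rw [← Subgroup.mul_mem_cancel_left _ h1]
    rcases hα with hα | hα
    · rw [← affReflection_two_smul hα]
      exact affReflection_mem (Or.inr ⟨α, hα, 0, by simp⟩)
    · have h2 := affReflection_eq α 1
      rw [coroot_of_mem_longRoots hα, one_smul] at h2
      rw [← h2]
      exact affReflection_mem (Or.inl ⟨α, Or.inr hα, 1, by simp⟩)
  · rw [transl_zero]
    exact one_mem _
  · intro x y _ _ hx hy
    rw [transl_add]
    exact mul_mem hx hy
  · intro x _ hx
    have h1 : transl (-x) = (transl x)⁻¹ := by
      rw [eq_inv_iff_mul_eq_one, ← transl_add, neg_add_cancel, transl_zero]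
    rw [h1]
    exact inv_mem hx

theorem isIntegral_of_mem_rootLattice {ξ : FinSpace ℓ} (h : ξ ∈ rootLattice ℓ) :
    IsIntegral ξ := by
  refine AddSubgroup.closure_induction (p := fun ξ _ => IsIntegral ξ) ?_ ?_ ?_ ?_ h
  · intro α hα
    exact isIntegral_of_mem_roots hα
  · exact fun i => ⟨0, by simp⟩
  · intro x y _ _ hx hy
    exact hx.add hy
  · intro x _ hx
    exact hx.neg

theorem mem_rootLattice_of_mem_roots {α : FinSpace ℓ} (h : α ∈ roots ℓ) : α ∈ rootLattice ℓ :=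
  AddSubgroup.subset_closure h

theorem weyl_mem_rootLattice {w : FinAut ℓ} (hw : w ∈ weylGroup ℓ) {ξ : FinSpace ℓ}
    (h : ξ ∈ rootLattice ℓ) : w ξ ∈ rootLattice ℓ := by
  refine AddSubgroup.closure_induction (p := fun ξ _ => w ξ ∈ rootLattice ℓ) ?_ ?_ ?_ ?_ h
  · intro α hα
    exact mem_rootLattice_of_mem_roots (weyl_mem_roots hw hα)
  · simp
  · intro x y _ _ hx hy
    rw [map_add]
    exact add_mem hx hy
  · intro x _ hx
    rw [map_neg]
    exact neg_mem hx

theorem incl_mul_transl_mem_affRoots {u : FinAut ℓ} (hu : u ∈ weylGroup ℓ) {ζ : FinSpace ℓ}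
    (hζ : IsIntegral ζ) {β : AffSpace ℓ} (h : β ∈ affRoots ℓ) :
    (incl u * transl ζ) β ∈ affRoots ℓ := by
  rw [incl_mul_transl_apply]
  rcases h with ⟨α, hα, n, rfl⟩ | ⟨α, hα, n, rfl⟩
  · obtain ⟨k, hk⟩ := (isIntegral_of_mem_roots hα).dotProduct hζ
    exact Or.inl ⟨u α, weyl_mem_roots hu hα, n - k, by simp [hk]⟩
  · obtain ⟨k, hk⟩ := (isIntegral_of_mem_roots (Or.inl hα)).dotProduct hζ
    refine Or.inr ⟨u α, weyl_mem_shortRoots hu hα, n - k, ?_⟩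
    simp only [map_smul, smul_dotProduct, hk, smul_eq_mul, Int.cast_sub, Prod.mk.injEq, true_and]
    ring

/-! ### The set `(W^J)_af` -/

/-- A condition on `u` and `ζ` describing when `u t_ζ` belongs to `(W^J)_af`. -/
def SignCompatible (J : Set (Fin ℓ)) (u : FinAut ℓ) (ζ : FinSpace ℓ) : Prop :=
  ∀ η ∈ posRootsJ J, (coroot η ⬝ᵥ ζ = 0 ∧ 0 < heightComp u η) ∨
    (coroot η ⬝ᵥ ζ = -1 ∧ heightComp u η < 0)

theorem SignCompatible.mem_petersonReps {J : Set (Fin ℓ)} {u : FinAut ℓ} {ζ : FinSpace ℓ}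
    (hu : u ∈ weylGroup ℓ) (hζ : ζ ∈ rootLattice ℓ) (h : SignCompatible J u ζ) :
    incl u * transl ζ ∈ petersonReps J := by
  have hint := isIntegral_of_mem_rootLattice hζ
  refine ⟨mul_mem (incl_mem_affWeylGroup hu) (transl_mem_affWeylGroup hζ), fun β hβ hspan => ?_⟩
  refine ⟨incl_mul_transl_mem_affRoots hu hint hβ.1, ?_⟩
  obtain ⟨hroot, hpos⟩ := hβ
  rw [incl_mul_transl_apply]
  rcases hroot with ⟨α, hα, n, rfl⟩ | ⟨α, hα, n, rfl⟩
  · simp only at hpos hspan ⊢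
    rcases lt_or_gt_of_ne (height_ne_zero hα) with hneg | hαpos
    · have hη : -α ∈ posRootsJ J := ⟨(neg_mem_posRoots_iff hα).mpr hneg, neg_mem hspan⟩
      have hn : (1 : ℚ) ≤ n := by
        rcases hpos with h1 | ⟨-, h1⟩
        · have : 0 < n := by exact_mod_cast h1
          exact_mod_cast this
        · have := (mem_posRoots_iff.mp h1).2
          linarith
      have hc := h _ hη
      rw [coroot_neg, neg_dotProduct, map_neg, neg_pos, neg_neg_iff_pos, neg_eq_zero,
        neg_inj] at hc
      rcases hα with hs | hl
      · rw [coroot_of_mem_shortRoots hs, smul_dotProduct, smul_eq_mul] at hc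
        left
        rcases hc with hc | hc <;> linarith [hc.1]
      · rw [coroot_of_mem_longRoots hl] at hc
        rcases hc with ⟨hc, -⟩ | ⟨hc, hp⟩
        · left
          linarith
        · rcases hn.lt_or_eq with hn | hn
          · left
            linarith
          · right
            exact ⟨by linarith, (weyl_mem_posRoots_iff hu (Or.inr hl)).mpr hp⟩
    · have hη : α ∈ posRootsJ J := ⟨mem_posRoots_iff.mpr ⟨hα, hαpos⟩, hspan⟩
      have hn : (0 : ℚ) ≤ n := by
        rcases hpos with h1 | ⟨h1, -⟩
        · exact h1.le
        · exact h1.ge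
      rcases h _ hη with ⟨hc, hp⟩ | ⟨hc, -⟩
      · have h0 : α ⬝ᵥ ζ = 0 := by
          rcases hα with hs | hl
          · rw [coroot_of_mem_shortRoots hs, smul_dotProduct, smul_eq_mul] at hc
            linarith
          · rwa [coroot_of_mem_longRoots hl] at hc
        rw [h0, sub_zero]
        rcases hn.lt_or_eq with hn | hn
        · exact Or.inl hn
        · exact Or.inr ⟨hn.symm, (weyl_mem_posRoots_iff hu hα).mpr hp⟩
      · have h0 : α ⬝ᵥ ζ < 0 := by
          rw [← coroot_dotProduct_neg_iff hα, hc]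
          norm_num
        left
        linarith
  · simp only at hpos hspan ⊢
    have hspan' : α ∈ spanJ J := by
      have := Submodule.smul_mem _ (1 / 2 : ℚ) hspan
      rwa [smul_smul, one_div, inv_mul_cancel₀ (by norm_num), one_smul] at this
    have hn : (0 : ℚ) < 2 * n + 1 := by
      rcases hpos with h1 | ⟨h1, -⟩
      · exact h1
      · have : 2 * n + 1 = 0 := by exact_mod_cast h1
        omega
    have hαr : α ∈ roots ℓ := Or.inl hα
    obtain ⟨k, hk⟩ := (isIntegral_of_mem_roots hαr).dotProduct hint
    -- For a short root the coroot pairing is `2k`, an even integer, so the value `-1` cannot occur.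
    have hk0 : k = 0 := by
      rcases lt_or_gt_of_ne (height_ne_zero hαr) with hneg | hαpos
      · have hc := h _ ⟨(neg_mem_posRoots_iff hαr).mpr hneg, neg_mem hspan'⟩
        rw [coroot_neg, neg_dotProduct, coroot_of_mem_shortRoots hα, smul_dotProduct, hk,
          smul_eq_mul] at hc
        rcases hc with ⟨hc, -⟩ | ⟨hc, -⟩
        · have : -(2 * k) = 0 := by exact_mod_cast hc
          omega
        · have : -(2 * k) = -1 := by exact_mod_cast hc
          omega
      · have hc := h _ ⟨mem_posRoots_iff.mpr ⟨hαr, hαpos⟩, hspan'⟩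
        rw [coroot_of_mem_shortRoots hα, smul_dotProduct, hk, smul_eq_mul] at hc
        rcases hc with ⟨hc, -⟩ | ⟨hc, -⟩
        · have : 2 * k = 0 := by exact_mod_cast hc
          omega
        · have : 2 * k = -1 := by exact_mod_cast hc
          omega
    left
    rw [smul_dotProduct, hk, hk0]
    simpa using hn

/-- It suffices to test the roots `η` and `-η + δ`, which confine `(η, ζ)` to `{-1, 0}` with the
matching sign of `uη`. For `η` short, the root `-2η + δ` also excludes `-1`. -/
theorem signCompatible_of_mem_petersonReps {J : Set (Fin ℓ)} {u : FinAut ℓ} {ζ : FinSpace ℓ}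
    (hu : u ∈ weylGroup ℓ) (hζ : ζ ∈ rootLattice ℓ) (h : incl u * transl ζ ∈ petersonReps J) :
    SignCompatible J u ζ := by
  have hint := isIntegral_of_mem_rootLattice hζ
  intro η hη
  have hηr := hη.1.1
  have hnr := neg_mem_roots hηr
  obtain ⟨k, hk⟩ := (isIntegral_of_mem_roots hηr).dotProduct hint
  have h1 := (h.2 (η, 0) ⟨Or.inl ⟨η, hηr, 0, by simp⟩, Or.inr ⟨rfl, hη.1⟩⟩ hη.2).2
  have h2 := (h.2 (-η, 1) ⟨Or.inl ⟨-η, hnr, 1, by simp⟩, Or.inl one_pos⟩ (neg_mem hη.2)).2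
  rw [incl_mul_transl_apply] at h1 h2
  simp only [zero_sub, neg_dotProduct, hk, neg_pos, neg_eq_zero, weyl_mem_posRoots_iff hu hηr,
    sub_neg_eq_add, map_neg, neg_weyl_mem_posRoots_iff hu hηr]
    at h1 h2
  have h1' : k < 0 ∨ k = 0 ∧ 0 < heightComp u η := by exact_mod_cast h1
  have h2' : 0 < 1 + k ∨ 1 + k = 0 ∧ heightComp u η < 0 := by exact_mod_cast h2
  rcases hηr with hs | hl
  · have h3 := (h.2 ((2 : ℚ) • (-η), 1)
      ⟨Or.inr ⟨-η, (mem_shortRoots_iff.mpr ⟨(mem_shortRoots_iff.mp hs).1.neg,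
        by simpa using (mem_shortRoots_iff.mp hs).2⟩), 0, by simp⟩, Or.inl one_pos⟩
      (Submodule.smul_mem _ _ (neg_mem hη.2))).2
    rw [incl_mul_transl_apply] at h3
    simp only [smul_dotProduct, neg_dotProduct, hk, smul_eq_mul] at h3
    have h3' : 0 ≤ 1 - 2 * -k := by
      rcases h3 with h3 | ⟨h3, -⟩
      · have : 0 < 1 - 2 * -k := by exact_mod_cast h3
        exact this.le
      · have : 1 - 2 * -k = 0 := by exact_mod_cast h3
        exact this.ge
    left
    rw [coroot_of_mem_shortRoots hs, smul_dotProduct, hk]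
    rcases h1' with h1' | ⟨h1', h4⟩
    · omega
    · rw [h1']
      exact ⟨by simp, h4⟩
  · rw [coroot_of_mem_longRoots hl, hk]
    rcases h1' with h1' | ⟨h1', h4⟩
    · right
      rcases h2' with h2' | ⟨h2', h4⟩
      · omega
      · have : k = -1 := by omega
        rw [this]
        exact ⟨by simp, h4⟩
    · left
      rw [h1']
      exact ⟨by simp, h4⟩

theorem mul_mem_petersonReps {J : Set (Fin ℓ)} {a : AffAut ℓ} {z : FinAut ℓ} {ξ : FinSpace ℓ}
    (ha : a ∈ petersonReps J) (hz : z ∈ weylGroupJ J) (hb : incl z * transl ξ ∈ petersonReps J) :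
    a * (incl z * transl ξ) ∈ petersonReps J :=
  ⟨mul_mem ha.1 hb.1, fun β hβ hspan =>
    ha.2 _ (hb.2 β hβ hspan) (weylGroupJ_mem_spanJ hz hspan)⟩

theorem incl_mem_petersonReps {J : Set (Fin ℓ)} {w : FinAut ℓ} (hw : w ∈ weylGroup ℓ)
    (h : ∀ η ∈ posRootsJ J, 0 < heightComp w η) : incl w ∈ petersonReps J := by
  have := SignCompatible.mem_petersonReps (J := J) hw (zero_mem _)
    fun η hη => Or.inl ⟨dotProduct_zero _, h η hη⟩
  rwa [transl_zero, mul_one] at this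

/-- Sign compatibility makes `2⟨ρ_J^∨, ζ⟩` equal to minus the number of inversions of `u` in `Δ_J⁺`,
which is minus the excess of `ℓ(u)` over the length of its minimal representative. -/
theorem siLength_of_mem_petersonReps {J : Set (Fin ℓ)} {u : FinAut ℓ} {ζ : FinSpace ℓ}
    (hu : u ∈ weylGroup ℓ) (hζ : ζ ∈ rootLattice ℓ) (h : incl u * transl ζ ∈ petersonReps J) :
    siLength (incl u * transl ζ) =
      length (minRep J u) + 2 * ((rhoCheck ℓ - rhoCheckJ J) ⬝ᵥ ζ) := by
  have hsign := signCompatible_of_mem_petersonReps hu hζ h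
  have hcount : 2 * (rhoCheckJ J ⬝ᵥ ζ) = -(negCount J (heightComp u) : ℚ) := by
    rw [two_mul_rhoCheckJ, negCount, Finset.card_filter]
    push_cast
    rw [← Finset.sum_neg_distrib]
    refine Finset.sum_congr rfl fun η hη => ?_
    rcases hsign η (mem_posFinset.mp hη) with ⟨h1, h2⟩ | ⟨h1, h2⟩
    · rw [h1, if_neg (not_lt.mpr h2.le), neg_zero]
    · rw [h1, if_pos h2]
  rw [siLength_incl_mul_transl hu hζ, length_eq_minRep_add (J := J) hu, sub_dotProduct, mul_sub,
    hcount]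
  push_cast
  ring

/-! ### The elements `z_ξ` -/

/-- The orbit of a functional under `W_J` meets the dominant chamber: each reflection in a simple
root with negative value lowers the number of negative values on `Δ_J⁺`. -/
theorem exists_weylGroupJ_nonneg (J : Set (Fin ℓ)) (n : ℕ) :
    ∀ f : FinSpace ℓ →ₗ[ℚ] ℚ, negCount J f = n →
      ∃ y ∈ weylGroupJ J, ∀ η ∈ posRootsJ J, 0 ≤ f (y η) := by
  induction n using Nat.strong_induction_on with
  | _ n ih =>
    intro f hf
    by_cases hc : ∀ j ∈ J, 0 ≤ f (simpleRoot j)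
    · exact ⟨1, one_mem _, fun η hη => nonneg_of_simpleRoot hc hη⟩
    · push Not at hc
      obtain ⟨j, hj, hneg⟩ := hc
      have h1 := negCount_comp_reflection_add_one hj hneg
      obtain ⟨y, hy, hpos⟩ := ih (negCount J (f ∘ₗ (reflection (simpleRoot j)).toLinearMap))
        (by omega) _ rfl
      exact ⟨reflection (simpleRoot j) * y, mul_mem (reflection_simpleRoot_mem hj) hy, hpos⟩

theorem exists_mem_petersonReps {J : Set (Fin ℓ)} {ξ : FinSpace ℓ} (hξ : ξ ∈ adjusted J) :
    ∃ z, z ∈ weylGroupJ J ∧ incl z * transl ξ ∈ petersonReps J := by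
  set M : ℚ := ∑ η ∈ posFinset Set.univ, height η
  have hM : ∀ η ∈ posRoots ℓ, height η ≤ M := fun η hη =>
    Finset.single_le_sum (f := fun η => height η)
      (fun η hη => (mem_posRoots_iff.mp (mem_posFinset_univ.mp hη)).2.le)
      (mem_posFinset_univ.mpr hη)
  -- Pairing with `ξ` dominates and the height breaks ties. As `M` bounds all heights and a pairing
  -- `⟨η^∨, ξ⟩ = -1` gives `(η, ξ) ≤ -1/2`, the factor `2M + 1` makes `f η` negative in that case.
  let f : FinSpace ℓ →ₗ[ℚ] ℚ :=
    { toFun := fun v => height v + (2 * M + 1) * (v ⬝ᵥ ξ)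
      map_add' := fun u v => by
        rw [map_add, add_dotProduct]
        ring
      map_smul' := fun c v => by
        rw [map_smul, smul_dotProduct, smul_eq_mul, smul_eq_mul, RingHom.id_apply, smul_eq_mul]
        ring }
  have hf : ∀ v, f v = height v + (2 * M + 1) * (v ⬝ᵥ ξ) := fun _ => rfl
  obtain ⟨y, hy, hpos⟩ := exists_weylGroupJ_nonneg J _ f rfl
  have hyW := weylGroupJ_le J hy
  refine ⟨y⁻¹, inv_mem hy, SignCompatible.mem_petersonReps (inv_mem hyW) hξ.1 fun η hη => ?_⟩
  have hyy : y ((y⁻¹ : FinAut ℓ) η) = η := y.apply_symm_apply η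
  have hr := weyl_mem_roots (inv_mem hyW) hη.1.1
  have hspan := weylGroupJ_mem_spanJ (inv_mem hy) hη.2
  have hηpos := (mem_posRoots_iff.mp hη.1).2
  have hηM := hM η hη.1
  rcases hξ.2 η hη with hc | hc
  · right
    refine ⟨hc, lt_of_le_of_ne (not_lt.mp fun hh => ?_) (heightComp_ne_zero (inv_mem hyW) hη.1.1)⟩
    have h1 := hpos _ ⟨mem_posRoots_iff.mpr ⟨hr, hh⟩, hspan⟩
    rw [hyy, hf] at h1
    have h2 : η ⬝ᵥ ξ ≤ -1 / 2 := by
      rcases hη.1.1 with hs | hl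
      · rw [coroot_of_mem_shortRoots hs, smul_dotProduct, smul_eq_mul] at hc
        linarith
      · rw [coroot_of_mem_longRoots hl] at hc
        linarith
    nlinarith
  · left
    refine ⟨hc, lt_of_le_of_ne (not_lt.mp fun hh => ?_)
      (heightComp_ne_zero (inv_mem hyW) hη.1.1).symm⟩
    have h1 := hpos _ ⟨(neg_mem_posRoots_iff hr).mpr hh, neg_mem hspan⟩
    rw [map_neg, map_neg, hyy, hf] at h1
    have h2 : η ⬝ᵥ ξ = 0 := by
      rcases hη.1.1 with hs | hl
      · rw [coroot_of_mem_shortRoots hs, smul_dotProduct, smul_eq_mul] at hc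
        linarith
      · rwa [coroot_of_mem_longRoots hl] at hc
    rw [h2] at h1
    linarith

/-- Only these two properties of `z_ξ` are used later; its uniqueness plays no role. -/
theorem zElt_spec {J : Set (Fin ℓ)} {ξ : FinSpace ℓ} (hξ : ξ ∈ adjusted J) :
    zElt J ξ ∈ weylGroupJ J ∧ incl (zElt J ξ) * transl ξ ∈ petersonReps J := by
  have h := exists_mem_petersonReps hξ
  rw [zElt, dif_pos h]
  exact h.choose_spec

/-! ### Edges of the semi-infinite Bruhat graph -/

theorem incl_mul_transl_mul {u z : FinAut ℓ} (hz : z ∈ weylGroup ℓ) (ζ ξ : FinSpace ℓ) :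
    incl u * transl ζ * (incl z * transl ξ) =
      incl (u * z) * transl ((z⁻¹ : FinAut ℓ) ζ + ξ) := by
  rw [mul_assoc, ← mul_assoc (transl ζ), transl_mul_incl hz, transl_add, incl_mul]
  simp only [mul_assoc]

theorem siLength_mul {J : Set (Fin ℓ)} {u z : FinAut ℓ} {ζ ξ : FinSpace ℓ}
    (hu : u ∈ weylGroup ℓ) (hz : z ∈ weylGroupJ J) (hζ : ζ ∈ rootLattice ℓ)
    (hξ : ξ ∈ rootLattice ℓ) (h : incl u * transl ζ * (incl z * transl ξ) ∈ petersonReps J) :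
    siLength (incl u * transl ζ * (incl z * transl ξ)) = length (minRep J u) +
      2 * ((rhoCheck ℓ - rhoCheckJ J) ⬝ᵥ ζ) + 2 * ((rhoCheck ℓ - rhoCheckJ J) ⬝ᵥ ξ) := by
  have hzW := weylGroupJ_le J hz
  rw [incl_mul_transl_mul hzW] at h ⊢
  rw [siLength_of_mem_petersonReps (mul_mem hu hzW)
    (add_mem (weyl_mem_rootLattice (inv_mem hzW) hζ) hξ) h, minRep_mul u hz, dotProduct_add,
    rhoCheck_sub_dotProduct_weyl (inv_mem hz)]
  ring

theorem length_minRep_of_mem_minReps {J : Set (Fin ℓ)} {w : FinAut ℓ} (hw : w ∈ minReps J) :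
    length (minRep J w) = length w := by
  obtain ⟨⟨u, hu, heq⟩, hmin⟩ := minRep_spec J w
  refine le_antisymm (by simpa using hmin 1 (one_mem _)) ?_
  rw [heq]
  exact hw.2 u hu

section Edges

variable {J : Set (Fin ℓ)} {w : FinAut ℓ} {ξ γ : FinSpace ℓ} (hw : w ∈ minReps J)
  (hξ : ξ ∈ adjusted J)
include hw hξ

theorem incl_mul_zElt_mem_petersonReps :
    incl w * (incl (zElt J ξ) * transl ξ) ∈ petersonReps J :=
  mul_mem_petersonReps
    (incl_mem_petersonReps hw.1 fun _ hη => heightComp_pos_of_mem_minReps hw hη)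
    (zElt_spec hξ).1 (zElt_spec hξ).2

theorem siLength_incl_mul_zElt :
    siLength (incl w * (incl (zElt J ξ) * transl ξ)) =
      length w + 2 * ((rhoCheck ℓ - rhoCheckJ J) ⬝ᵥ ξ) := by
  have h1 := incl_mul_zElt_mem_petersonReps hw hξ
  have h2 := siLength_mul (J := J) (ζ := 0) (ξ := ξ) hw.1 (zElt_spec hξ).1 (zero_mem _) hξ.1
  rw [transl_zero, mul_one, dotProduct_zero, length_minRep_of_mem_minReps hw] at h2
  rw [h2 h1]
  ring

/-- An element of `(W^J)_af` obtained from `w z_ξ t_ξ` by a reflection covers it if and only if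
the lengths of the finite parts are related accordingly. -/
theorem siLength_covers_iff {ζ : FinSpace ℓ} (hγ : γ ∈ roots ℓ) (hζ : ζ ∈ rootLattice ℓ)
    (hmem : incl (w * reflection γ) * transl ζ * (incl (zElt J ξ) * transl ξ) ∈ petersonReps J) :
    siLength (incl (w * reflection γ) * transl ζ * (incl (zElt J ξ) * transl ξ)) =
        siLength (incl w * (incl (zElt J ξ) * transl ξ)) + 1 ↔
      (length (minRep J (w * reflection γ)) : ℚ) =
        length w - 2 * ((rhoCheck ℓ - rhoCheckJ J) ⬝ᵥ ζ) + 1 := by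
  rw [siLength_mul (mul_mem hw.1 (reflection_mem_weylGroup hγ)) (zElt_spec hξ).1 hζ hξ.1 hmem,
    siLength_incl_mul_zElt hw hξ]
  constructor <;> intro h <;> linarith

/-- Conjugating by `z_ξ` turns the difference of lengths into `ℓ(v s_{γ'}) - ℓ(v) + 4⟨ρ^∨, γ'⟩` with
`v = w z_ξ` and `γ' = z_ξ⁻¹ γ`, which is never 1. -/
theorem siLength_ne_of_two_smul (hγ : γ ∈ posRoots ℓ \ posRootsJ J) :
    siLength (incl (w * reflection γ) * transl ((2 : ℚ) • γ) * (incl (zElt J ξ) * transl ξ)) ≠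
      siLength (incl w * (incl (zElt J ξ) * transl ξ)) + 1 := by
  have hz := (zElt_spec hξ).1
  set z := zElt J ξ
  have hzW := weylGroupJ_le J hz
  have hγ' := weylGroupJ_mem_diff (inv_mem hz) hγ
  have hlat : (z⁻¹ : FinAut ℓ) ((2 : ℚ) • γ) + ξ ∈ rootLattice ℓ := by
    refine add_mem ?_ hξ.1
    rw [map_smul, two_smul]
    have := mem_rootLattice_of_mem_roots hγ'.1.1
    exact add_mem this this
  have hs := reflection_mem_weylGroup hγ.1.1
  have hprod : w * reflection γ * z = w * z * reflection ((z⁻¹ : FinAut ℓ) γ) := by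
    rw [reflection_weyl (inv_mem hzW)]
    group
  rw [incl_mul_transl_mul hzW, ← mul_assoc, ← incl_mul,
    siLength_incl_mul_transl (mul_mem (mul_mem hw.1 hs) hzW) hlat,
    siLength_incl_mul_transl (mul_mem hw.1 hzW) hξ.1, hprod, dotProduct_add, map_smul,
    dotProduct_smul, smul_eq_mul]
  have := length_mul_reflection_add_four_ne hγ'.1 (mul_mem hw.1 hzW)
  intro h
  apply this
  linarith

end Edges

/-- The norm of `2wγ` is 4 or 8, so it is not a finite root and must be twice a short one. -/
theorem mem_shortRoots_of_two_smul_mem {γ : FinSpace ℓ} (hγ : γ ∈ roots ℓ) {w : FinAut ℓ}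
    (hw : w ∈ weylGroup ℓ) {n : ℚ} (h : ((2 : ℚ) • w γ, n) ∈ affRoots ℓ) : γ ∈ shortRoots ℓ := by
  have hdot := weyl_dotProduct hw γ γ
  have hnorm := (mem_roots_iff.mp hγ).2
  refine mem_shortRoots_iff.mpr ⟨(mem_roots_iff.mp hγ).1, ?_⟩
  rcases h with ⟨α, hα, k, heq⟩ | ⟨α, hα, k, heq⟩
  · have h1 := (mem_roots_iff.mp hα).2
    have h2 : (2 : ℚ) • w γ = α := (Prod.ext_iff.mp heq).1
    rw [← h2, smul_dotProduct, dotProduct_smul, hdot, smul_eq_mul,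
      smul_eq_mul] at h1
    rcases h1 with h1 | h1 <;> rcases hnorm with hnorm | hnorm <;> rw [hnorm] at h1 <;>
      norm_num at h1
  · have h1 : w γ = α := smul_right_injective _ (two_ne_zero (α := ℚ)) (Prod.ext_iff.mp heq).1
    rw [← hdot, h1, (mem_shortRoots_iff.mp hα).2]

section Edges

variable {J : Set (Fin ℓ)} {w : FinAut ℓ} {γ ζ : FinSpace ℓ} {β : AffSpace ℓ}
  (hw : w ∈ minReps J) (hγ : γ ∈ posRoots ℓ \ posRootsJ J)
  (hβ : affReflection β * incl w = incl (w * reflection γ) * transl ζ)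
include hw hγ hβ

theorem length_minRep_of_siBGEdge {ξ : FinSpace ℓ} (hξ : ξ ∈ adjusted J) (hζ : ζ ∈ rootLattice ℓ)
    (hedge : SiBGEdge J (incl w * incl (zElt J ξ) * transl ξ) β
      (affReflection β * (incl w * incl (zElt J ξ) * transl ξ))) :
    (length (minRep J (w * reflection γ)) : ℚ) =
      length w - 2 * ((rhoCheck ℓ - rhoCheckJ J) ⬝ᵥ ζ) + 1 := by
  obtain ⟨-, hy, -, -, hlen⟩ := hedge
  rw [mul_assoc (incl w), ← mul_assoc (affReflection β), hβ] at hy hlen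
  exact (siLength_covers_iff hw hξ hγ.1.1 hζ hy).mp hlen

theorem siBGEdge_of_signCompatible (hmem : β ∈ posAffRoots ℓ) (hζ : ζ ∈ rootLattice ℓ)
    (hsign : SignCompatible J (w * reflection γ) ζ)
    (hlen : (length (minRep J (w * reflection γ)) : ℚ) =
      length w - 2 * ((rhoCheck ℓ - rhoCheckJ J) ⬝ᵥ ζ) + 1) {ξ : FinSpace ℓ}
    (hξ : ξ ∈ adjusted J) :
    SiBGEdge J (incl w * incl (zElt J ξ) * transl ξ) β
      (affReflection β * (incl w * incl (zElt J ξ) * transl ξ)) := by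
  have hy := mul_mem_petersonReps
    (hsign.mem_petersonReps (mul_mem hw.1 (reflection_mem_weylGroup hγ.1.1)) hζ)
    (zElt_spec hξ).1 (zElt_spec hξ).2
  have hl := (siLength_covers_iff hw hξ hγ.1.1 hζ hy).mpr hlen
  rw [← hβ, mul_assoc] at hy hl
  rw [mul_assoc (incl w)]
  exact ⟨incl_mul_zElt_mem_petersonReps hw hξ, hy, hmem, rfl, hl⟩

end Edges

end TwistedA

/-! ### The correspondence of edges -/

open TwistedA
theorem mainTheorem3 (ℓ : ℕ) (hℓ : 1 ≤ ℓ) (J : Set (Fin ℓ)) :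
    (∀ (w : FinSpace ℓ ≃ₗ[ℚ] FinSpace ℓ) (ξ γ : FinSpace ℓ) (β : AffSpace ℓ)
        (x : AffSpace ℓ ≃ₗ[ℚ] AffSpace ℓ),
      w ∈ minReps J → ξ ∈ adjusted J → x = incl w * incl (zElt J ξ) * transl ξ →
      β ∈ posAffRoots ℓ → SiBGEdge J x β (affReflection β * x) →
      γ ∈ posRoots ℓ \ posRootsJ J →
        (β = (w γ, 0) → QBGBruhatEdge J w γ (minRep J (w * reflection γ))) ∧
        (β = (w γ, 1) ∨ β = ((2 : ℚ) • w γ, 1) →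
          QBGQuantumEdge J w γ (minRep J (w * reflection γ)))) ∧
    (∀ (w : FinSpace ℓ ≃ₗ[ℚ] FinSpace ℓ) (γ : FinSpace ℓ),
      w ∈ minReps J → γ ∈ posRoots ℓ \ posRootsJ J →
        (QBGBruhatEdge J w γ (minRep J (w * reflection γ)) →
          ((w γ, 0) : AffSpace ℓ) ∈ posAffRoots ℓ ∧
          ∀ ξ ∈ adjusted J,
            SiBGEdge J (incl w * incl (zElt J ξ) * transl ξ) (w γ, 0)
              (affReflection (w γ, 0) * (incl w * incl (zElt J ξ) * transl ξ))) ∧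
        (QBGQuantumEdge J w γ (minRep J (w * reflection γ)) → γ ∈ longRoots ℓ →
          ((w γ, 1) : AffSpace ℓ) ∈ posAffRoots ℓ ∧
          ∀ ξ ∈ adjusted J,
            SiBGEdge J (incl w * incl (zElt J ξ) * transl ξ) (w γ, 1)
              (affReflection (w γ, 1) * (incl w * incl (zElt J ξ) * transl ξ))) ∧
        (QBGQuantumEdge J w γ (minRep J (w * reflection γ)) → γ ∈ shortRoots ℓ →
          (((2 : ℚ) • w γ, 1) : AffSpace ℓ) ∈ posAffRoots ℓ ∧
          ∀ ξ ∈ adjusted J,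
            SiBGEdge J (incl w * incl (zElt J ξ) * transl ξ) ((2 : ℚ) • w γ, 1)
              (affReflection ((2 : ℚ) • w γ, 1) *
                (incl w * incl (zElt J ξ) * transl ξ)))) := by
  constructor
  · rintro w ξ γ β x hw hξ rfl - hedge hγ
    have hmin := minRep_mem_minReps J (mul_mem hw.1 (reflection_mem_weylGroup hγ.1.1))
    have hγQ := mem_rootLattice_of_mem_roots hγ.1.1
    have hquantum (h : affReflection β * incl w = incl (w * reflection γ) * transl γ) :
        QBGQuantumEdge J w γ (minRep J (w * reflection γ)) :=
      ⟨hw, hmin, hγ, rfl, length_minRep_of_siBGEdge hw hγ h hξ hγQ hedge⟩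
    refine ⟨?_, ?_⟩
    · rintro rfl
      have h := affReflection_mul_incl hw.1 γ 0
      rw [zero_smul] at h
      have hlen := length_minRep_of_siBGEdge hw hγ h hξ (zero_mem _) hedge
      rw [dotProduct_zero, mul_zero, sub_zero] at hlen
      exact ⟨hw, hmin, hγ, rfl, by exact_mod_cast hlen⟩
    · rintro (rfl | rfl)
      · have h := affReflection_mul_incl hw.1 γ 1
        rcases hγ.1.1 with hs | hl
        -- For `γ` short and `β = wγ + δ` the translation is by `γ^∨ = 2γ`, the case in which no
        -- edge exists.
        · rw [one_smul, coroot_of_mem_shortRoots hs] at h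
          have hlen := hedge.2.2.2.2
          rw [mul_assoc (incl w), ← mul_assoc (affReflection _), h] at hlen
          exact absurd hlen (siLength_ne_of_two_smul hw hξ hγ)
        · rw [one_smul, coroot_of_mem_longRoots hl] at h
          exact hquantum h
      · exact hquantum (affReflection_two_smul_mul_incl hw.1
          (mem_shortRoots_of_two_smul_mem hγ.1.1 hw.1 hedge.2.2.1.1))
  · intro w γ hw hγ
    have hγQ := mem_rootLattice_of_mem_roots hγ.1.1
    refine ⟨fun hedge => ?_, fun hedge hl => ?_, fun hedge hs => ?_⟩
    · have hlen := hedge.2.2.2.2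
      obtain ⟨hpos, hsign⟩ := heightComp_pos_of_bruhatEdge hw hγ hlen
      have hmem : ((w γ, 0) : AffSpace ℓ) ∈ posAffRoots ℓ :=
        ⟨Or.inl ⟨w γ, weyl_mem_roots hw.1 hγ.1.1, 0, by simp⟩,
          Or.inr ⟨rfl, (weyl_mem_posRoots_iff hw.1 hγ.1.1).mpr hpos⟩⟩
      have h := affReflection_mul_incl hw.1 γ 0
      rw [zero_smul] at h
      refine ⟨hmem, fun ξ hξ => siBGEdge_of_signCompatible hw hγ h hmem (zero_mem _)
        (fun η hη => Or.inl ⟨dotProduct_zero _, hsign η hη⟩) ?_ hξ⟩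
      rw [dotProduct_zero, hlen]
      push_cast
      ring
    · have hlen := hedge.2.2.2.2
      have hmem : ((w γ, 1) : AffSpace ℓ) ∈ posAffRoots ℓ :=
        ⟨Or.inl ⟨w γ, weyl_mem_roots hw.1 hγ.1.1, 1, by simp⟩, Or.inl one_pos⟩
      have h := affReflection_mul_incl hw.1 γ 1
      rw [one_smul, coroot_of_mem_longRoots hl] at h
      exact ⟨hmem, fun ξ hξ => siBGEdge_of_signCompatible hw hγ h hmem hγQ
        (fun η hη => heightComp_of_quantumEdge hw hγ hlen hη) hlen hξ⟩
    · have hlen := hedge.2.2.2.2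
      have hmem : (((2 : ℚ) • w γ, 1) : AffSpace ℓ) ∈ posAffRoots ℓ :=
        ⟨Or.inr ⟨w γ, weyl_mem_shortRoots hw.1 hs, 0, by simp⟩, Or.inl one_pos⟩
      have h := affReflection_two_smul_mul_incl hw.1 hs
      exact ⟨hmem, fun ξ hξ => siBGEdge_of_signCompatible hw hγ h hmem hγQ
        (fun η hη => heightComp_of_quantumEdge hw hγ hlen hη) hlen hξ⟩
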